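/- Let $k$ be an algebraically closed field of characteristic zero, $A$ a finitely generated commutative unital associative $k$-algebra, $X=\operatorname{Spec}A$, and $\mathfrak g$ a finite-dimensional semisimple Lie algebra over $k$. Let $\Gamma$ be a finite abelian group acting by $k$-algebra automorphisms on $A$ (hence on $X$) and by Lie algebra automorphisms on $\mathfrak g$, and assume that $\Gamma$ acts freely on the set $X_{\rm rat}$ of rational points of $X$ (with maximal ideals $\mathfrak m_x$). Let $(\mathfrak g\otimes A)^\Gamma$ be the Lie algebra of fixed points of the diagonal action. Let $X_*$ be the set of finite subsets of $X_{\rm rat}$ containing no two distinct points of the same $\Gamma$-orbit. Let $P^+$ be the set of dominant integral weights of $\mathfrak g$, identified with the set of isomorphism classes of irreducible finite-dimensional $\mathfrak g$-modules; $\Gamma$ acts on it by $\gamma\cdot[\rho]=[\rho\circ\gamma^{-1}]$. Let $\mathcal E$ be the set of finitely supported functions $\psi:X_{\rm rat}\to P^+$ and $\mathcal E^\Gamma\subseteq\mathcal E$ the subset of $\Gamma$-equivariant ones. For $\psi\in\mathcal E$, $\mathrm{ev}_\psi$ is the isomorphism class of the $(\mathfrak g\otimes A)$-module $\bigotimes_{y\in\operatorname{Supp}\psi}V(\psi(y))$,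 the $y$-th factor being a module through evaluation at $y$; for $\psi\in\mathcal E^\Gamma$, $\mathrm{ev}^\Gamma_\psi$ is the isomorphism class of the analogous $(\mathfrak g\otimes A)^\Gamma$-module, with $y$ running over a set of representatives of the $\Gamma$-orbits in $\operatorname{Supp}\psi$. The support of a module in either class is $\operatorname{Supp}\psi$. Let $\mathcal F$ and $\mathcal F^\Gamma$ be the categories of finite-dimensional modules over $\mathfrak g\otimes A$ and $(\mathfrak g\otimes A)^\Gamma$. For $\mathbf x\in X_*$ let $\mathcal F_{\mathbf x}\subseteq\mathcal F$ (resp. $\mathcal F^\Gamma_{\mathbf x}\subseteq\mathcal F^\Gamma$) be the full subcategory of modules all of whose irreducible constituents have support contained in $\mathbf x$ (resp. in $\Gamma\cdot\mathbf x$). The twisting functor $\mathbf T:\mathcal F\to\mathcal F^\Gamma$ is restriction from $\mathfrak g\otimes A$ to $(\mathfrak g\otimes A)^\Gamma$. For $\eta:X_{\rm rat}\to\mathbb N$ with finite support put $I_\eta=\prod_y\mathfrak m_y^{\eta(y)}$. If $\operatorname{Supp}\eta\in X_*$ then the inclusion induces an isomorphism $(\mathfrak g\otimes A)^\Gamma/(\mathfrak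 g\otimes I_\eta)^\Gamma\cong(\mathfrak g\otimes A)/(\mathfrak g\otimes I_\eta)$, and if $V\in\mathcal F^\Gamma$ is annihilated by $(\mathfrak g\otimes I_\eta)^\Gamma$, then $V^\eta$ denotes the space $V$ with the action of $\mathfrak g\otimes A$ given by $\mathfrak g\otimes A\to(\mathfrak g\otimes A)/(\mathfrak g\otimes I_\eta)\cong(\mathfrak g\otimes A)^\Gamma/(\mathfrak g\otimes I_\eta)^\Gamma\to\operatorname{End}V$. **Theorem.** Let $\mathbf x\in X_*$. 1. If $\psi\in\mathcal E$ and $\operatorname{Supp}\psi\in X_*$, then $\mathbf T$ maps the class $\mathrm{ev}_\psi$ to the class $\mathrm{ev}^\Gamma_{\psi^\Gamma}$, where $\psi^\Gamma\in\mathcal E^\Gamma$ is given by $\psi^\Gamma(y)=\sum_{\gamma\in\Gamma}\gamma\cdot\psi(\gamma^{-1}\cdot y)$. 2. $\mathbf T$ restricts to a functor $\mathbf T_{\mathbf x}:\mathcal F_{\mathbf x}\to\mathcal F^\Gamma_{\mathbf x}$, and there is a well-defined functor $\mathbf U_{\mathbf x}:\mathcal F^\Gamma_{\mathbf x}\to\mathcal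 F_{\mathbf x}$ (untwisting): every $V\in\mathcal F^\Gamma_{\mathbf x}$ is annihilated by $(\mathfrak g\otimes I_\eta)^\Gamma$ for some $\eta$ with $\operatorname{Supp}\eta\subseteq\mathbf x$, one has $\mathbf U_{\mathbf x}(V)=V^\eta$ for every such $\eta$, and $\mathbf U_{\mathbf x}$ sends a morphism to the same underlying linear map. 3. If $\psi\in\mathcal E^\Gamma$ and $\operatorname{Supp}\psi\subseteq\Gamma\cdot\mathbf x$, then the modules in $\mathrm{ev}^\Gamma_\psi$ lie in $\mathcal F^\Gamma_{\mathbf x}$, and $\mathbf U_{\mathbf x}$ maps the class $\mathrm{ev}^\Gamma_\psi$ to the class $\mathrm{ev}_{\psi_{\mathbf x}}$, where $\psi_{\mathbf x}\in\mathcal E$ equals $\psi$ on $\mathbf x$ and $0$ elsewhere. 4. $\mathbf T_{\mathbf x}$ and $\mathbf U_{\mathbf x}$ are mutually inverse isomorphisms of categories: $\mathbf U_{\mathbf x}\mathbf T_{\mathbf x}$ and $\mathbf T_{\mathbf x}\mathbf U_{\mathbf x}$ are equal to the identity functors. -/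

import Mathlib

open TensorProduct CategoryTheory

universe u v w

noncomputable section

namespace EquivMap

/-! ### Finite-dimensional representations of a Lie algebra -/

section FDMod

attribute [local instance 100] LieRing.ofAssociativeRing

/-- A finite-dimensional representation of the Lie algebra `L` over `k`. -/
structure FDMod (k : Type u) (L : Type v) [Field k] [LieRing L] [LieAlgebra k L] where
  carrier : Type w
  [addCommGroup : AddCommGroup carrier]
  [module : Module k carrier]
  [finite : FiniteDimensional k carrier]
  ρ : L →ₗ⁅k⁆ Module.End k carrier

attribute [instance] FDMod.addCommGroup FDMod.module FDMod.finite

variable {k : Type u} {L : Type v} [Field k] [LieRing L] [LieAlgebra k L]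

instance : CoeSort (FDMod.{u, v, w} k L) (Type w) := ⟨FDMod.carrier⟩

instance (V : FDMod.{u, v, w} k L) : LieRingModule L V := LieRingModule.compLieHom V.carrier V.ρ

instance (V : FDMod.{u, v, w} k L) : LieModule k L V := LieModule.compLieHom V.carrier V.ρ

lemma FDMod.lie_def (V : FDMod.{u, v, w} k L) (x : L) (m : V) : ⁅x, m⁆ = V.ρ x m := rfl

/-- The category of finite-dimensional representations: morphisms are all `L`-module maps. -/
instance : Category (FDMod.{u, v, w} k L) where
  Hom V W := V →ₗ⁅k, L⁆ W
  id V := LieModuleHom.id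
  comp f g := g.comp f

/-- A Lie module, as a bundled representation. -/
def FDMod.of (M : Type w) [AddCommGroup M] [Module k M] [FiniteDimensional k M]
    [LieRingModule L M] [LieModule k L M] : FDMod.{u, v, w} k L where
  carrier := M
  ρ := LieModule.toEnd k L M

/-- `S` is an irreducible constituent of `V`: it is irreducible, and isomorphic to `N / N'` for
submodules `N' ≤ N` of `V`. -/
def IsConstituent (S V : FDMod.{u, v, w} k L) : Prop :=
  LieModule.IsIrreducible k L S ∧ ∃ N' N : LieSubmodule k L V, N' ≤ N ∧
    Nonempty (S ≃ₗ⁅k, L⁆ (N ⧸ N'.comap N.incl))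

/-- Pull-back of a representation along a Lie algebra homomorphism. -/
def FDMod.pullback {L' : Type*} [LieRing L'] [LieAlgebra k L'] (f : L' →ₗ⁅k⁆ L)
    (V : FDMod.{u, v, w} k L) : FDMod k L' where
  carrier := V
  ρ := V.ρ.comp f

/-- The functor of restriction along a Lie algebra homomorphism. -/
def FDMod.restriction {L' : Type*} [LieRing L'] [LieAlgebra k L'] (f : L' →ₗ⁅k⁆ L) :
    FDMod.{u, v, w} k L ⥤ FDMod.{u, _, w} k L' where
  obj V := V.pullback f
  map {V W} φ :=
    { toLinearMap := φ.toLinearMap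
      map_lie' := fun {x m} => φ.map_lie (f x) m }

open Classical in
/-- The tensor product of a finite family of representations of `L`: `x` acts on
`⨂ i, M i` by `∑ i, 1 ⊗ ⋯ ⊗ ρ i x ⊗ ⋯ ⊗ 1`. -/
def tensorRep {ι : Type*} [Fintype ι] {M : ι → Type*} [∀ i, AddCommGroup (M i)]
    [∀ i, Module k (M i)] (ρ : ∀ i, L →ₗ⁅k⁆ Module.End k (M i)) :
    L →ₗ⁅k⁆ Module.End k (⨂[k] i, M i) where
  toFun x := ∑ i, PiTensorProduct.map (Function.update (fun _ => LinearMap.id) i (ρ i x))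
  map_add' x y := by
    simp only [map_add, PiTensorProduct.map_update_add, Finset.sum_add_distrib]
  map_smul' c x := by
    simp only [map_smul, PiTensorProduct.map_update_smul, Finset.smul_sum, RingHom.id_apply]
  map_lie' {x y} := by
    have key : ∀ i j, (PiTensorProduct.map (Function.update (fun _ => LinearMap.id) i (ρ i x)) *
        PiTensorProduct.map (Function.update (fun _ => LinearMap.id) j (ρ j y)) -
        PiTensorProduct.map (Function.update (fun _ => LinearMap.id) j (ρ j y)) *
        PiTensorProduct.map (Function.update (fun _ => LinearMap.id) i (ρ i x)) :
          Module.End k (⨂[k] i, M i)) =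
        if i = j then
          PiTensorProduct.map (Function.update (fun _ => LinearMap.id) i (ρ i ⁅x, y⁆)) else 0 := by
      intro i j
      rw [← PiTensorProduct.map_mul, ← PiTensorProduct.map_mul]
      split_ifs with h
      · subst h
        have h1 : ∀ a b : Module.End k (M i),
            (fun l => (Function.update (fun _ => LinearMap.id) i a : ∀ l, Module.End k (M l)) l *
              (Function.update (fun _ => LinearMap.id) i b : ∀ l, Module.End k (M l)) l) =
            Function.update (fun _ => LinearMap.id) i (a * b) := by
          intro a b
          funext l
          by_cases hl : l = i
          · subst hl; simp
          · simp only [Function.update_of_ne hl]; rfl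
        rw [h1, h1, LieHom.map_lie, Ring.lie_def]
        exact ((PiTensorProduct.mapMultilinear k M M).map_update_sub _ i _ _).symm
      · rw [sub_eq_zero]
        congr 1
        funext l
        by_cases hl : l = i
        · subst hl
          simp only [Function.update_self, Function.update_of_ne h]; rfl
        · simp only [Function.update_of_ne hl]; rfl
    rw [Ring.lie_def, Finset.sum_mul_sum, Finset.sum_mul_sum]
    rw [Finset.sum_comm (f := fun i j => PiTensorProduct.map
      (Function.update (fun _ => LinearMap.id) i (ρ i y)) * _)]
    simp only [← Finset.sum_sub_distrib, key, Finset.sum_ite_eq, Finset.mem_univ, if_true]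

variable (k L) in
/-- The one-dimensional trivial representation. -/
def FDMod.triv : FDMod.{u, v, u} k L where
  carrier := k
  addCommGroup := Ring.toAddCommGroup
  ρ := 0

end FDMod

/-! ### Irreducible representations of `g` and dominant integral weights -/

section PPlus

variable (k : Type u) (g : Type v) [Field k] [LieRing g] [LieAlgebra k g]

/-- Irreducible finite-dimensional representations of `g`. -/
def IrrRep : Type (max v (u + 1)) :=
  {V : FDMod.{u, v, u} k g // LieModule.IsIrreducible k g V}

/-- Isomorphism of irreducible representations. -/
instance irrSetoid : Setoid (IrrRep k g) where
  r V W := Nonempty (V.1 ≃ₗ⁅k, g⁆ W.1)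
  iseqv := ⟨fun _ => ⟨LieModuleEquiv.refl⟩, fun ⟨e⟩ => ⟨e.symm⟩, fun ⟨e⟩ ⟨f⟩ => ⟨e.trans f⟩⟩

/-- The set `P⁺` of dominant integral weights, identified with the set of isomorphism classes of
irreducible finite-dimensional `g`-modules (`λ` corresponds to the class of `V(λ)`). -/
def PPlus : Type (max v (u + 1)) := Quotient (irrSetoid k g)

variable {k g}

/-- The isomorphism class of an irreducible representation. -/
def IrrRep.cls (V : IrrRep k g) : PPlus k g := Quotient.mk _ V

variable (k g)

/-- The one-dimensional trivial representation. -/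
def trivRep : IrrRep k g :=
  ⟨FDMod.triv k g, by
    have : Nontrivial (FDMod.triv k g).carrier := inferInstanceAs (Nontrivial k)
    refine LieModule.IsIrreducible.mk fun N hN => ?_
    rw [← LieSubmodule.toSubmodule_eq_top]
    rw [ne_eq, ← LieSubmodule.toSubmodule_eq_bot] at hN
    exact (eq_bot_or_eq_top (α := Submodule k k) _).resolve_left hN⟩

/-- The weight `0` is the class of the trivial representation. -/
instance : Zero (PPlus k g) := ⟨(trivRep k g).cls⟩

variable {k g}

/-- A Borel subalgebra: a maximal solvable subalgebra. -/
def IsBorel (B : LieSubalgebra k g) : Prop :=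
  Maximal (fun B : LieSubalgebra k g => LieAlgebra.IsSolvable B) B

/-- `μ` is the sum in `P⁺` of the finite family `lam`, expressed through the corresponding
irreducible modules: if `v i` is a highest weight vector of `V (lam i)` (all with respect to the
same Borel subalgebra), then `⨂ v i` is a highest weight vector of weight `∑ lam i` in
`⨂ V (lam i)`, so that the irreducible submodule containing it is `V (∑ lam i)`. -/
def IsWeightSum {ι : Type*} [Fintype ι] (lam : ι → PPlus k g) (μ : PPlus k g) : Prop :=
  ∃ (V : ι → IrrRep k g) (U : IrrRep k g), (∀ i, (V i).cls = lam i) ∧ U.cls = μ ∧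
    ∃ (B : LieSubalgebra k g) (v : ∀ i, (V i).1), IsBorel B ∧
      (∀ i, v i ≠ 0 ∧ ∀ b ∈ B, ∃ c : k, ⁅b, v i⁆ = c • v i) ∧
      ∃ f : U.1 →ₗ[k] ⨂[k] i, (V i).1,
        Function.Injective f ∧ (∀ (a : g) (m : U.1), f ⁅a, m⁆ = tensorRep (fun i => (V i).1.ρ) a (f m)) ∧
        PiTensorProduct.tprod k v ∈ LinearMap.range f

open Classical in
/-- The sum in `P⁺` of a finite family. -/
def weightSum {ι : Type*} [Fintype ι] (lam : ι → PPlus k g) : PPlus k g :=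
  if h : ∃ μ, IsWeightSum lam μ then h.choose else 0

end PPlus

/-- An action of a group on a Lie algebra by Lie algebra automorphisms (`k`-linearity is a separate
`SMulCommClass` assumption). -/
class LieMulAction (Γ : Type*) (g : Type*) [Group Γ] [LieRing g] extends DistribMulAction Γ g where
  smul_bracket : ∀ (γ : Γ) (a b : g), γ • ⁅a, b⁆ = ⁅γ • a, γ • b⁆

section Twist

variable {k : Type u} {g : Type v} {Γ : Type*} [Field k] [LieRing g] [LieAlgebra k g]
  [Group Γ] [LieMulAction Γ g] [SMulCommClass Γ k g]

variable (k g) in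
/-- The automorphism of `g` given by `γ`. -/
def gAut (γ : Γ) : g →ₗ⁅k⁆ g :=
  { DistribSMul.toLinearMap k g γ with
    map_lie' := fun {a b} => LieMulAction.smul_bracket γ a b }

@[simp] lemma gAut_apply (γ : Γ) (a : g) : gAut k g γ a = γ • a := rfl

/-- The representation `ρ ∘ γ⁻¹`. -/
def IrrRep.twist (γ : Γ) (V : IrrRep k g) : IrrRep k g :=
  ⟨V.1.pullback (gAut k g γ⁻¹), by
    have := V.2
    have : Nontrivial (V.1.pullback (gAut k g γ⁻¹)).carrier :=
      LieModule.nontrivial_of_isIrreducible k g V.1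
    refine LieModule.IsIrreducible.mk fun N hN => ?_
    let N' : LieSubmodule k g V.1 :=
      { N.toSubmodule with
        lie_mem := fun {a m} hm => by
          have h := N.lie_mem (x := γ • a) hm
          change ⁅γ⁻¹ • γ • a, (m : V.1)⁆ ∈ N.toSubmodule at h
          rwa [inv_smul_smul] at h }
    have h' := eq_bot_or_eq_top N'
    rw [← LieSubmodule.toSubmodule_eq_bot, ← LieSubmodule.toSubmodule_eq_top] at h'
    rw [← LieSubmodule.toSubmodule_eq_top]
    rw [ne_eq, ← LieSubmodule.toSubmodule_eq_bot] at hN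
    exact h'.resolve_left hN⟩

/-- The action of `Γ` on `P⁺`: `γ • [ρ] = [ρ ∘ γ⁻¹]`. -/
instance : SMul Γ (PPlus k g) where
  smul γ := Quotient.map (IrrRep.twist γ) (by
    rintro V W ⟨e⟩
    exact ⟨{ toLinearMap := e.toLinearEquiv.toLinearMap
             map_lie' := fun {a m} => e.toLieModuleHom.map_lie (γ⁻¹ • a) m
             invFun := e.symm
             left_inv := e.symm_apply_apply
             right_inv := e.apply_symm_apply }⟩)

end Twist

/-! ### Rational points, the equivariant map algebra, and evaluation -/

section Points

variable (k : Type u) (A : Type v) {Γ : Type*} [Field k] [CommRing A] [Algebra k A] [Group Γ]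
  [MulSemiringAction Γ A] [SMulCommClass Γ k A]

/-- The rational points of `X = Spec A`, as `k`-algebra maps `A → k`; the maximal ideal of the
point `x` is its kernel. -/
def RatPt : Type _ := A →ₐ[k] k

variable {k A}

/-- The value of `a ∈ A` at the point `x`. -/
def RatPt.eval (x : RatPt k A) : A →ₐ[k] k := x

/-- The maximal ideal of a rational point. -/
def RatPt.maxIdeal (x : RatPt k A) : Ideal A := RingHom.ker x.eval

lemma RatPt.ext {x y : RatPt k A} (h : ∀ a, x.eval a = y.eval a) : x = y := AlgHom.ext h

/-- `Γ` acts on the points by `(γ • x)(a) = x(γ⁻¹ • a)`. -/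
instance : MulAction Γ (RatPt k A) where
  smul γ x := x.eval.comp (MulSemiringAction.toAlgHom k A γ⁻¹)
  one_smul x := by
    refine RatPt.ext fun a => ?_
    change x.eval ((1 : Γ)⁻¹ • a) = _
    simp
  mul_smul γ δ x := by
    refine RatPt.ext fun a => ?_
    change x.eval ((γ * δ)⁻¹ • a) = x.eval (δ⁻¹ • γ⁻¹ • a)
    rw [mul_inv_rev, mul_smul]

lemma RatPt.smul_eval (γ : Γ) (x : RatPt k A) (a : A) : (γ • x).eval a = x.eval (γ⁻¹ • a) := rfl

variable (Γ) in
/-- `Γ` acts freely on the rational points. -/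
def ActsFreely (k : Type u) (A : Type v) [Field k] [CommRing A] [Algebra k A]
    [MulSemiringAction Γ A] [SMulCommClass Γ k A] : Prop :=
  ∀ (γ : Γ) (x : RatPt k A), γ • x = x → γ = 1

variable (Γ) in
/-- The finite sets of rational points that contain no two distinct points of one `Γ`-orbit. -/
def XStar (k : Type u) (A : Type v) [Field k] [CommRing A] [Algebra k A]
    [MulSemiringAction Γ A] [SMulCommClass Γ k A] : Set (Finset (RatPt k A)) :=
  {s | ∀ x ∈ s, ∀ y ∈ s, (∃ γ : Γ, γ • x = y) → x = y}

variable (Γ) in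
/-- `Γ · Y`, the union of the orbits of the points of `Y`. -/
def orbits (Y : Set (RatPt k A)) : Set (RatPt k A) := {z | ∃ γ : Γ, ∃ y ∈ Y, z = γ • y}

variable (Γ) in
/-- `Y_Γ`: the (finite) subsets of `Y` containing exactly one point of each `Γ`-orbit in `Y`. -/
def transversals (Y : Set (RatPt k A)) : Set (Finset (RatPt k A)) :=
  {s | (s : Set (RatPt k A)) ⊆ Y ∧ ∀ y ∈ Y, ∃! z, z ∈ s ∧ ∃ γ : Γ, z = γ • y}

/-- `I_η = ∏ 𝔪_x ^ η(x)`. -/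
def powIdeal (η : RatPt k A →₀ ℕ) : Ideal A := η.prod fun x n => x.maxIdeal ^ n

end Points

section MapAlgebra

variable (k : Type*) (A : Type*) (g : Type*) (Γ : Type*) [Field k] [CommRing A] [Algebra k A]
  [LieRing g] [LieAlgebra k g] [Group Γ] [MulSemiringAction Γ A] [SMulCommClass Γ k A]
  [LieMulAction Γ g] [SMulCommClass Γ k g]

variable {Γ} in
/-- The diagonal action of `γ` on `g ⊗ A` (written `A ⊗ g`): `γ (a ⊗ u) = γ a ⊗ γ u`. -/
def diag (γ : Γ) : A ⊗[k] g →ₗ[k] A ⊗[k] g :=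
  TensorProduct.map (DistribSMul.toLinearMap k A γ) (DistribSMul.toLinearMap k g γ)

variable {k A g Γ}

@[simp] lemma diag_tmul (γ : Γ) (a : A) (u : g) :
    diag k A g γ (a ⊗ₜ u) = (γ • a) ⊗ₜ (γ • u) := rfl

lemma diag_lie (γ : Γ) (α β : A ⊗[k] g) :
    diag k A g γ ⁅α, β⁆ = ⁅diag k A g γ α, diag k A g γ β⁆ := by
  induction α with
  | zero => simp
  | add α₁ α₂ h₁ h₂ => simp only [add_lie, map_add, h₁, h₂]
  | tmul a u =>
    induction β with
    | zero => simp
    | add β₁ β₂ h₁ h₂ => simp only [lie_add, map_add, h₁, h₂]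
    | tmul b v =>
      simp only [LieAlgebra.ExtendScalars.bracket_tmul, diag_tmul, smul_mul',
        LieMulAction.smul_bracket]

variable (k A g Γ) in
/-- The equivariant map algebra `(g ⊗ A)^Γ`. -/
def EMA : LieSubalgebra k (A ⊗[k] g) where
  carrier := {α | ∀ γ : Γ, diag k A g γ α = α}
  zero_mem' γ := map_zero _
  add_mem' {α β} hα hβ γ := by rw [map_add, hα γ, hβ γ]
  smul_mem' c α hα γ := by rw [map_smul, hα γ]
  lie_mem' {α β} hα hβ γ := by rw [diag_lie, hα γ, hβ γ]

/-- Evaluation `g ⊗ A → g`, `α ↦ α(x)`, at a rational point `x`. -/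
def evalAt (x : RatPt k A) : A ⊗[k] g →ₗ⁅k⁆ g where
  toLinearMap := (TensorProduct.lid k g).toLinearMap ∘ₗ
    TensorProduct.map x.eval.toLinearMap LinearMap.id
  map_lie' {α β} := by
    simp only [AddHom.toFun_eq_coe, LinearMap.coe_toAddHom]
    induction α with
    | zero => simp
    | add α₁ α₂ h₁ h₂ => simp only [add_lie, map_add, h₁, h₂]
    | tmul a u =>
      induction β with
      | zero => simp
      | add β₁ β₂ h₁ h₂ => simp only [lie_add, map_add, h₁, h₂]
      | tmul b v => 
        simpa [LieAlgebra.ExtendScalars.bracket_tmul, mul_smul] using smul_comm _ _ _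

variable (Γ) in
/-- Evaluation `(g ⊗ A)^Γ → g` at a rational point. -/
def evalAtΓ (x : RatPt k A) : EMA k A g Γ →ₗ⁅k⁆ g := (evalAt x).comp (EMA k A g Γ).incl

variable (g) in
/-- `g ⊗ I` inside `g ⊗ A`, for an ideal `I` of `A`. -/
def tensorIdeal (I : Ideal A) : Submodule A (A ⊗[k] g) := I • ⊤

end MapAlgebra

/-! ### Evaluation representations and the categories of modules with bounded support -/

section Evaluation

variable {k : Type u} {A : Type*} {g : Type*} {Γ : Type*} [Field k] [CommRing A] [Algebra k A]
  [LieRing g] [LieAlgebra k g] [Group Γ] [MulSemiringAction Γ A] [SMulCommClass Γ k A]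
  [LieMulAction Γ g] [SMulCommClass Γ k g]

/-- `V` belongs to the isomorphism class of the evaluation representation
`⨂_{x ∈ s} ψ(x) ∘ ev_x`, where `ev_x : L → g` are given evaluation maps (`L` is `g ⊗ A` or
`(g ⊗ A)^Γ`). For `s = ∅` this is the class of the one-dimensional trivial representation. -/
def IsEvalRep {L : Type*} [LieRing L] [LieAlgebra k L] (ev : RatPt k A → (L →ₗ⁅k⁆ g))
    (s : Finset (RatPt k A)) (ψ : RatPt k A → PPlus k g) (V : FDMod.{u, _, w} k L) : Prop :=
  ∃ R : s → IrrRep k g, (∀ x, (R x).cls = ψ x) ∧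
    ∃ φ : V ≃ₗ[k] ⨂[k] x : s, (R x).1, ∀ (α : L) (m : V),
      φ ⁅α, m⁆ = tensorRep (fun x : s => ((R x).1.pullback (ev x)).ρ) α (φ m)

/-- The support of a function `ψ : X_rat → P⁺`. -/
def supp (ψ : RatPt k A → PPlus k g) : Set (RatPt k A) := {x | ψ x ≠ 0}

variable (k A g) in
/-- The set `𝓔` of finitely supported functions `X_rat → P⁺`. -/
def EE : Set (RatPt k A → PPlus k g) := {ψ | (supp ψ).Finite}

variable (k A g Γ) in
/-- The set `𝓔^Γ` of `Γ`-equivariant functions in `𝓔`. -/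
def EEΓ : Set (RatPt k A → PPlus k g) :=
  {ψ | ψ ∈ EE k A g ∧ ∀ (γ : Γ) (x : RatPt k A), ψ (γ • x) = γ • ψ x}

/-- `V` belongs to the isomorphism class `ev_ψ` of `(g ⊗ A)`-modules. -/
def IsEv (ψ : RatPt k A → PPlus k g) (V : FDMod.{u, _, w} k (A ⊗[k] g)) : Prop :=
  ∃ s : Finset (RatPt k A), (s : Set (RatPt k A)) = supp ψ ∧ IsEvalRep evalAt s ψ V

/-- `V` belongs to the isomorphism class `ev^Γ_ψ` of `(g ⊗ A)^Γ`-modules: evaluate at a set of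
representatives of the `Γ`-orbits in the support of `ψ`. -/
def IsEvΓ (ψ : RatPt k A → PPlus k g) (V : FDMod.{u, _, w} k (EMA k A g Γ)) : Prop :=
  ∃ s ∈ transversals Γ (supp ψ), IsEvalRep (evalAtΓ Γ) s ψ V

variable (g) in
/-- The full subcategory `𝓕_x`: the `(g ⊗ A)`-modules all of whose irreducible constituents have
support contained in `x`. -/
def FX (x : Finset (RatPt k A)) : ObjectProperty (FDMod.{u, _, w} k (A ⊗[k] g)) :=
  fun V => ∀ S : FDMod.{u, _, w} k (A ⊗[k] g), IsConstituent S V →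
    ∃ ψ ∈ EE k A g, IsEv ψ S ∧ supp ψ ⊆ x

variable (g Γ) in
/-- The full subcategory `𝓕^Γ_x`: the `(g ⊗ A)^Γ`-modules all of whose irreducible constituents
have support contained in `Γ · x`. -/
def FXΓ (x : Finset (RatPt k A)) : ObjectProperty (FDMod.{u, _, w} k (EMA k A g Γ)) :=
  fun V => ∀ S : FDMod.{u, _, w} k (EMA k A g Γ), IsConstituent S V →
    ∃ ψ ∈ EEΓ k A g Γ, IsEvΓ ψ S ∧ supp ψ ⊆ orbits Γ (x : Set (RatPt k A))

/-- `ψ^Γ(x) = ∑_γ γ • ψ(γ⁻¹ • x)`, the sum being taken in `P⁺`. -/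
def twistFun [Fintype Γ] (ψ : RatPt k A → PPlus k g) : RatPt k A → PPlus k g :=
  fun x => weightSum fun γ : Γ => γ • ψ (γ⁻¹ • x)

open Classical in
/-- `ψ_x`: equal to `ψ` on `x` and to `0` elsewhere. -/
def restrictFun (x : Finset (RatPt k A)) (ψ : RatPt k A → PPlus k g) : RatPt k A → PPlus k g :=
  fun y => if y ∈ x then ψ y else 0

end Evaluation

/-! ### The twisting and untwisting functors -/

section Functors

variable {k : Type u} {A : Type*} {g : Type*} {Γ : Type*} [Field k] [CommRing A] [Algebra k A]
  [LieRing g] [LieAlgebra k g] [Group Γ] [MulSemiringAction Γ A] [SMulCommClass Γ k A]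
  [LieMulAction Γ g] [SMulCommClass Γ k g]

variable (k A g Γ) in
/-- The twisting functor `T`: restriction from `g ⊗ A` to `(g ⊗ A)^Γ`. -/
def twistFunctor : FDMod.{u, _, w} k (A ⊗[k] g) ⥤ FDMod.{u, _, w} k (EMA k A g Γ) :=
  FDMod.restriction (EMA k A g Γ).incl

/-- `(g ⊗ I)^Γ` annihilates `V`. -/
def Annihilates (I : Ideal A) (V : FDMod.{u, _, w} k (EMA k A g Γ)) : Prop :=
  ∀ α : EMA k A g Γ, (α : A ⊗[k] g) ∈ tensorIdeal g I → ∀ m : V, ⁅α, m⁆ = 0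

variable (g Γ) in
/-- The map `(g ⊗ A)^Γ → (g ⊗ A) / (g ⊗ I)` is surjective. -/
def FixedSurj (I : Ideal A) : Prop :=
  ∀ β : A ⊗[k] g, ∃ α : EMA k A g Γ, (α : A ⊗[k] g) - β ∈ tensorIdeal g I

lemma RatPt.maxIdeal_injective {x y : RatPt k A} (h : x.maxIdeal = y.maxIdeal) : x = y := by
  refine RatPt.ext fun a => ?_
  have h1 : a - algebraMap k A (x.eval a) ∈ x.maxIdeal := by
    simp [RatPt.maxIdeal, RingHom.mem_ker]
  rw [h] at h1
  have h2 : y.eval a - x.eval a = 0 := by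
    simpa [RatPt.maxIdeal, RingHom.mem_ker] using h1
  exact (sub_eq_zero.mp h2).symm

lemma RatPt.maxIdeal_isMaximal (x : RatPt k A) : x.maxIdeal.IsMaximal :=
  RingHom.ker_isMaximal_of_surjective _ fun c => ⟨algebraMap k A c, by simp⟩

/-- A prime ideal containing `I_η` contains some `𝔪_x` with `x` in the support of `η`. -/
lemma exists_maxIdeal_le {η : RatPt k A →₀ ℕ} {P : Ideal A} (hP : P.IsPrime)
    (h : powIdeal η ≤ P) : ∃ x ∈ η.support, x.maxIdeal ≤ P := by
  obtain ⟨x, hx, hle⟩ := (Ideal.IsPrime.prod_le hP).mp h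
  exact ⟨x, hx, hP.le_of_pow_le hle⟩

/-- The ideals `I_η` and `γ⁻¹ I_η` are coprime for `γ ≠ 1`. -/
lemma coprime_translate (hfree : ActsFreely Γ k A) {s : Finset (RatPt k A)}
    (hs : s ∈ XStar Γ k A) {η : RatPt k A →₀ ℕ} (hη : η.support ⊆ s) {γ : Γ} (hγ : γ ≠ 1) :
    powIdeal η ⊔ (powIdeal η).comap (MulSemiringAction.toRingHom Γ A γ) = ⊤ := by
  by_contra hne
  obtain ⟨M, hM, hle⟩ := Ideal.exists_le_maximal _ hne
  obtain ⟨x, hx, hxM⟩ := exists_maxIdeal_le hM.isPrime (le_sup_left.trans hle)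
  have hxM' : x.maxIdeal = M := x.maxIdeal_isMaximal.eq_of_le hM.ne_top hxM
  have hP : (M.comap (MulSemiringAction.toRingHom Γ A γ⁻¹)).IsPrime := hM.isPrime.comap _
  obtain ⟨y, hy, hyM⟩ := exists_maxIdeal_le hP (η := η) (fun a ha => by
    refine hle (le_sup_right (a := powIdeal η) ?_)
    change γ • γ⁻¹ • a ∈ powIdeal η
    rwa [smul_inv_smul])
  have h1 : (γ⁻¹ • y).maxIdeal = x.maxIdeal := by
    refine (γ⁻¹ • y).maxIdeal_isMaximal.eq_of_le x.maxIdeal_isMaximal.ne_top fun a ha => ?_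
    rw [hxM']
    have h2 : γ • a ∈ y.maxIdeal := by
      rw [RatPt.maxIdeal, RingHom.mem_ker] at ha ⊢
      rw [← ha]
      change y.eval (γ • a) = y.eval ((γ⁻¹)⁻¹ • a)
      rw [inv_inv]
    have h3 : γ⁻¹ • γ • a ∈ M := hyM h2
    rwa [inv_smul_smul] at h3
  have h4 := RatPt.maxIdeal_injective h1
  have h5 : y = x := hs y (hη hy) x (hη hx) ⟨γ⁻¹, h4⟩
  subst h5
  exact hγ (inv_eq_one.mp (hfree _ _ h4))

lemma diag_smul (γ : Γ) (a : A) (α : A ⊗[k] g) :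
    diag k A g γ (a • α) = (γ • a) • diag k A g γ α := by
  induction α with
  | zero => simp
  | add α₁ α₂ h₁ h₂ => simp only [smul_add, map_add, h₁, h₂]
  | tmul b u => simp [TensorProduct.smul_tmul', smul_mul']

lemma diag_diag (γ δ : Γ) (α : A ⊗[k] g) :
    diag k A g γ (diag k A g δ α) = diag k A g (γ * δ) α := by
  induction α with
  | zero => simp
  | add α₁ α₂ h₁ h₂ => simp only [map_add, h₁, h₂]
  | tmul b u => simp [mul_smul]

lemma diag_one (α : A ⊗[k] g) : diag k A g (1 : Γ) α = α := by
  induction α with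
  | zero => simp
  | add α₁ α₂ h₁ h₂ => simp only [map_add, h₁, h₂]
  | tmul b u => simp

/-- If the support of `η` lies in a member of `X_*`, then `(g ⊗ A)^Γ → (g ⊗ A) / (g ⊗ I_η)` is
surjective, so that `(g ⊗ A)^Γ / (g ⊗ I_η)^Γ ≅ (g ⊗ A) / (g ⊗ I_η)`. -/
lemma fixedSurj [Finite Γ] (hfree : ActsFreely Γ k A) {s : Finset (RatPt k A)}
    (hs : s ∈ XStar Γ k A) {η : RatPt k A →₀ ℕ} (hη : η.support ⊆ s) :
    FixedSurj (k := k) g Γ (powIdeal η) := by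
  classical
  have := Fintype.ofFinite Γ
  have hcop := Ideal.sup_iInf_eq_top (I := powIdeal η) (s := Finset.univ.erase (1 : Γ))
    (J := fun γ => (powIdeal η).comap (MulSemiringAction.toRingHom Γ A γ))
    (fun γ hγ => coprime_translate hfree hs hη (Finset.ne_of_mem_erase hγ))
  obtain ⟨e, he, f, hf, hef⟩ := Submodule.mem_sup.mp ((Ideal.eq_top_iff_one _).mp hcop)
  have hf' : ∀ γ : Γ, γ ≠ 1 → γ • f ∈ powIdeal η := fun γ hγ => by
    have := (Submodule.mem_iInf _).mp hf γ
    exact (Submodule.mem_iInf _).mp this (Finset.mem_erase.mpr ⟨hγ, Finset.mem_univ _⟩)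
  intro β
  refine ⟨⟨∑ γ : Γ, diag k A g γ (f • β), fun δ => ?_⟩, ?_⟩
  · simp only [map_sum, diag_diag]
    exact Fintype.sum_equiv (Equiv.mulLeft δ) _ _ fun _ => rfl
  · change (∑ γ : Γ, diag k A g γ (f • β)) - β ∈ _
    rw [← Finset.add_sum_erase _ _ (Finset.mem_univ (1 : Γ)), diag_one]
    have h1 : f • β - β = -(e • β) := by
      rw [← eq_sub_iff_add_eq'] at hef
      rw [hef, sub_smul, one_smul, sub_sub_cancel_left]
    rw [add_sub_right_comm, h1]
    refine add_mem (neg_mem (Submodule.smul_mem_smul he trivial)) (sum_mem fun γ hγ => ?_)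
    rw [diag_smul]
    exact Submodule.smul_mem_smul (hf' γ (Finset.ne_of_mem_erase hγ)) trivial

lemma lie_mem_tensorIdeal (I : Ideal A) (α : A ⊗[k] g) {β : A ⊗[k] g}
    (hβ : β ∈ tensorIdeal g I) : ⁅α, β⁆ ∈ tensorIdeal g I := by
  refine Submodule.smul_induction_on hβ (fun a ha γ _ => ?_) (fun γ δ hγ hδ => ?_)
  · rw [lie_smul]
    exact Submodule.smul_mem_smul ha trivial
  · rw [lie_add]
    exact add_mem hγ hδ

section Untwist

attribute [local instance 100] LieRing.ofAssociativeRing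

variable {I : Ideal A} (hI : FixedSurj (k := k) g Γ I)

lemma Annihilates.rho_eq {V : FDMod.{u, _, w} k (EMA k A g Γ)} (hV : Annihilates I V)
    {α α' : EMA k A g Γ} (h : (α : A ⊗[k] g) - α' ∈ tensorIdeal g I) : V.ρ α = V.ρ α' := by
  ext m
  have h1 : V.ρ (α - α') m = 0 := hV (α - α') h m
  rwa [map_sub, LinearMap.sub_apply, sub_eq_zero] at h1

/-- The `(g ⊗ A)`-module obtained from a `(g ⊗ A)^Γ`-module `V` annihilated by `(g ⊗ I)^Γ` through
`g ⊗ A → (g ⊗ A)/(g ⊗ I) ≅ (g ⊗ A)^Γ/(g ⊗ I)^Γ → End V`: the action of `β` is that of any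
`α ∈ (g ⊗ A)^Γ` with `α - β ∈ g ⊗ I`. For `I = I_η` this is `V^η`. -/
def untwist (V : FDMod.{u, _, w} k (EMA k A g Γ)) (hV : Annihilates I V) :
    FDMod.{u, _, w} k (A ⊗[k] g) where
  carrier := V
  ρ :=
    { toFun := fun β => V.ρ (hI β).choose
      map_add' := fun β β' => by
        rw [← map_add]
        refine hV.rho_eq ?_
        have h1 := (hI β).choose_spec
        have h2 := (hI β').choose_spec
        have h3 := (hI (β + β')).choose_spec
        convert sub_mem h3 (add_mem h1 h2) using 1
        push_cast
        abel
      map_smul' := fun c β => by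
        rw [RingHom.id_apply, ← map_smul]
        refine hV.rho_eq ?_
        have h1 := (hI β).choose_spec
        have h3 := (hI (c • β)).choose_spec
        convert sub_mem h3 (Submodule.smul_mem _ (algebraMap k A c) h1) using 1
        rw [algebraMap_smul, smul_sub]
        push_cast
        abel
      map_lie' := fun {β β'} => by
        rw [← LieHom.map_lie]
        refine hV.rho_eq ?_
        have h1 := (hI β).choose_spec
        have h2 := (hI β').choose_spec
        have h3 := (hI ⁅β, β'⁆).choose_spec
        have h4 := lie_mem_tensorIdeal I ((hI β).choose : A ⊗[k] g) h2
        have h5 := lie_mem_tensorIdeal I β' h1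
        convert add_mem (sub_mem h3 h4) h5 using 1
        rw [LieSubalgebra.coe_bracket, lie_sub, lie_sub, ← lie_skew β' β,
          ← lie_skew β' ((hI β).choose : A ⊗[k] g)]
        abel }

/-- Characterization of the action on `untwist`. -/
lemma untwist_rho (V : FDMod.{u, _, w} k (EMA k A g Γ)) (hV : Annihilates I V)
    (β : A ⊗[k] g) (α : EMA k A g Γ) (h : (α : A ⊗[k] g) - β ∈ tensorIdeal g I) :
    (untwist hI V hV).ρ β = V.ρ α := by
  refine hV.rho_eq ?_
  convert sub_mem (hI β).choose_spec h using 1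
  abel

/-- A morphism `V → W` of `(g ⊗ A)^Γ`-modules is also a morphism between the untwisted modules. -/
def untwistMap {V W : FDMod.{u, _, w} k (EMA k A g Γ)} (hV : Annihilates I V)
    (hW : Annihilates I W) (f : V ⟶ W) : untwist hI V hV ⟶ untwist hI W hW :=
  { toLinearMap := LieModuleHom.toLinearMap (L := EMA k A g Γ) (M := V.carrier) (N := W.carrier) f
    map_lie' := fun {β m} =>
      (LieModuleHom.map_lie (L := EMA k A g Γ) (M := V.carrier) (N := W.carrier) f
        (hI β).choose (m : V.carrier) :) }

end Untwist

/-- `U` is the untwisting functor `U_x : 𝓕^Γ_x → 𝓕_x`. Every `V` in `𝓕^Γ_x` is annihilated by some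
`(g ⊗ I_η)^Γ` with `η` supported in `x`; for every such `η`, `U` maps `V` to `V^η`; and `U` maps
a morphism to itself, considered as a morphism of `(g ⊗ A)`-modules. -/
structure IsUntwisting [Finite Γ] (hfree : ActsFreely Γ k A) {x : Finset (RatPt k A)}
    (hx : x ∈ XStar Γ k A)
    (U : (FXΓ.{u, w} g Γ x).FullSubcategory ⥤ (FX.{u, w} g x).FullSubcategory) : Prop where
  exists_annihilates : ∀ V : (FXΓ.{u, w} g Γ x).FullSubcategory,
    ∃ η : RatPt k A →₀ ℕ, η.support ⊆ x ∧ Annihilates (powIdeal η) V.obj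
  obj_eq : ∀ (V : (FXΓ.{u, w} g Γ x).FullSubcategory) (η : RatPt k A →₀ ℕ) (hη : η.support ⊆ x)
    (hV : Annihilates (powIdeal η) V.obj),
    (U.obj V).obj = untwist (fixedSurj hfree hx hη) V.obj hV
  map_eq : ∀ (V W : (FXΓ.{u, w} g Γ x).FullSubcategory) (f : V ⟶ W) (η : RatPt k A →₀ ℕ)
    (hη : η.support ⊆ x) (hV : Annihilates (powIdeal η) V.obj)
    (hW : Annihilates (powIdeal η) W.obj),
    (U.map f).hom = eqToHom (obj_eq V η hη hV) ≫
      untwistMap (fixedSurj hfree hx hη) hV hW f.hom ≫ eqToHom (obj_eq W η hη hW).symm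

/-- The restricted twisting functor `T_x : 𝓕_x → 𝓕^Γ_x`, once `T` is known to map `𝓕_x` to
`𝓕^Γ_x`. -/
def twistFunctorAt (x : Finset (RatPt k A))
    (hT : ∀ V : (FX.{u, w} g x).FullSubcategory,
      FXΓ.{u, w} g Γ x ((twistFunctor k A g Γ).obj V.obj)) :
    (FX.{u, w} g x).FullSubcategory ⥤ (FXΓ.{u, w} g Γ x).FullSubcategory :=
  (FXΓ.{u, w} g Γ x).lift ((FX.{u, w} g x).ι ⋙ twistFunctor k A g Γ) hT

end Functors

end EquivMap

end

/-! The action of `Γ` on rational points is free and `x` meets each orbit at most once, so `I_η` is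
coprime to its nontrivial translates when `η` is supported in `x`. By `fixedSurj`, every element of
`g ⊗ A` is then congruent to a fixed one modulo `g ⊗ I_η`. On a module killed by `g ⊗ I_η` the two
Lie algebras therefore act through the same operators, and they have the same submodules,
constituents and morphisms there. Both functors leave spaces and linear maps alone, so the
composites equal the identities once the actions agree. What remains is to bound annihilators and to
identify evaluation modules.

Annihilators (`FX.exists_annihilates`, `FXΓ.exists_annihilates`): let `J` be the product of the
maximal ideals of `x`, or the ideal of `Γ · x` in the twisted case. Elements with coefficients in
`J` kill all constituents, so they act by strictly triangular operators and long products of them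
vanish. Iterated brackets span the elements with coefficients in a power of `J`, so those act by
zero. Untwisted, this is perfectness of `g`. For fixed points it is `fixedIdeal_mul_le`: freeness
gives `a i`, `b i` with `∑ a i * γ • b i` equal to `1` at `γ = 1` and `0` elsewhere, and with the
trace this writes a fixed element as a sum of brackets of fixed elements. A fixed element of `g ⊗
I_η` also lies in all translates, and coprimality puts it in `g ⊗ J ^ n` when `η` is `n` on `x`.

Evaluation modules: if `supp ψ` is in `X_*`, at most one summand of `ψ^Γ(y)` is nonzero, so
restriction keeps the tensor factors. Conversely, `α(γ y) = γ α(y)` for fixed `α` moves the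
evaluation points into `x` at the price of twisting the factors. Modules in `ev^Γ_ψ` are irreducible
by Burnside's theorem, hence are their own only constituents. -/

noncomputable section

namespace EquivMap

/-! ### Burnside's theorem and irreducibility of tensor products -/

section Burnside

variable {k : Type*} [Field k] [IsAlgClosed k]

/-- Burnside's theorem: a subalgebra of `End V` acting irreducibly on `V` is all of `End V`. -/
theorem subalgebra_eq_top_of_irreducible {V : Type*} [AddCommGroup V] [Module k V]
    [FiniteDimensional k V] [Nontrivial V] (B : Subalgebra k (Module.End k V))
    (h : ∀ W : Submodule k V, (∀ b ∈ B, ∀ w ∈ W, b w ∈ W) → W = ⊥ ∨ W = ⊤) : B = ⊤ := by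
  have hsimple : IsSimpleModule B V := by
    rw [isSimpleModule_iff]
    refine { toNontrivial := inferInstance, eq_bot_or_eq_top := fun W => ?_ }
    rcases h (W.restrictScalars k) (fun b hb w hw => W.smul_mem (⟨b, hb⟩ : B) hw) with h' | h'
    · left; simpa using h'
    · right; simpa using h'
  have hend := (IsSimpleModule.algebraMap_end_bijective_of_isAlgClosed (A := B) (V := V) k).2
  rw [eq_top_iff]
  intro f _
  -- By Schur's lemma `B`-endomorphisms are scalars, so any `k`-linear `f` commutes with them;
  -- density then matches `f` with an element of `B` on a finite spanning set.
  let f' : Module.End (Module.End B V) V :=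
    { f with
      map_smul' := fun e m => by
        obtain ⟨c, rfl⟩ := hend e
        change f (c • m) = c • f m
        exact map_smul f c m }
  obtain ⟨s, hs⟩ := (Module.Finite.fg_top : (⊤ : Submodule k V).FG)
  obtain ⟨b, hb⟩ := jacobson_density f' s
  have : f = b := by
    refine LinearMap.ext_on hs fun m hm => hb m hm
  rw [this]
  exact b.2

variable {ι : Type*} [Fintype ι] {M : ι → Type*} [∀ i, AddCommGroup (M i)]
  [∀ i, Module k (M i)] [∀ i, FiniteDimensional k (M i)] [∀ i, Nontrivial (M i)]

open Classical in
/-- A subspace of `⨂ M i` that is stable under operators on the single factors, those on each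
factor acting irreducibly, is zero or everything. -/
theorem piTensor_eq_bot_or_eq_top {L : Type*} (ρ : ∀ i, L → Module.End k (M i))
    (h : ∀ i (W : Submodule k (M i)), (∀ a, ∀ w ∈ W, ρ i a w ∈ W) → W = ⊥ ∨ W = ⊤)
    (N : Submodule k (⨂[k] i, M i))
    (hN : ∀ i a, ∀ m ∈ N,
      PiTensorProduct.map (Function.update (fun _ => LinearMap.id) i (ρ i a)) m ∈ N) :
    N = ⊥ ∨ N = ⊤ := by
  have hmul : ∀ (f₁ f₂ : ∀ i, Module.End k (M i)) (m : ⨂[k] i, M i),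
      PiTensorProduct.map (fun i => f₁ i * f₂ i) m =
        PiTensorProduct.map f₁ (PiTensorProduct.map f₂ m) := fun f₁ f₂ m => by
    rw [PiTensorProduct.map_mul]; rfl
  have hsingle : ∀ i (f : Module.End k (M i)), ∀ m ∈ N,
      PiTensorProduct.map (Function.update (fun _ => LinearMap.id) i f) m ∈ N := by
    intro i
    -- The operators whose extension to slot `i` preserves `N` form a subalgebra containing all `ρ i
    -- a`; Burnside makes it everything.
    let B : Subalgebra k (Module.End k (M i)) :=
      { carrier := {f | ∀ m ∈ N,
          PiTensorProduct.map (Function.update (fun _ => LinearMap.id) i f) m ∈ N}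
        mul_mem' := fun {f f'} hf hf' m hm => by
          have h1 := hf _ (hf' m hm)
          rw [← hmul] at h1
          convert h1 using 3
          funext l
          by_cases hl : l = i
          · subst hl; simp
          · simp only [Function.update_of_ne hl]; rfl
        add_mem' := fun {f f'} hf hf' m hm => by
          rw [PiTensorProduct.map_update_add]
          exact add_mem (hf m hm) (hf' m hm)
        algebraMap_mem' := fun c m hm => by
          rw [Algebra.algebraMap_eq_smul_one, PiTensorProduct.map_update_smul]
          refine N.smul_mem c ?_
          convert hm
          rw [show (1 : Module.End k (M i)) = (fun j => (LinearMap.id : M j →ₗ[k] M j)) i from rfl,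
            Function.update_eq_self, PiTensorProduct.map_id, LinearMap.id_apply] }
    have hB : B = ⊤ := subalgebra_eq_top_of_irreducible B fun W hW =>
      h i W fun a w hw => hW _ (fun m hm => hN i a m hm) w hw
    intro f
    exact (hB ▸ Algebra.mem_top : f ∈ B)
  have hall : ∀ f : ∀ i, Module.End k (M i), ∀ m ∈ N, PiTensorProduct.map f m ∈ N := by
    intro f
    have key : ∀ s : Finset ι, ∀ m ∈ N, PiTensorProduct.map
        (fun i => if i ∈ s then f i else LinearMap.id) m ∈ N := by
      intro s
      induction s using Finset.induction_on with
      | empty => intro m hm; simpa using hm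
      | insert i s his ih =>
        intro m hm
        have h1 := hsingle i (f i) _ (ih m hm)
        rw [← hmul] at h1
        convert h1 using 3
        funext l
        by_cases hl : l = i
        · subst hl
          simp only [Finset.mem_insert_self, if_true, Function.update_self, his, if_false]; rfl
        · simp only [Function.update_of_ne hl, Finset.mem_insert, hl, false_or]; rfl
    simpa using key Finset.univ
  rw [or_iff_not_imp_left]
  intro hne
  obtain ⟨w, hw, hw0⟩ := N.ne_bot_iff.mp hne
  let b := fun i => Module.finBasis k (M i)
  let bb := Basis.piTensorProduct b
  obtain ⟨p, hp⟩ : ∃ p, bb.repr w p ≠ 0 := by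
    by_contra hcon
    push Not at hcon
    exact hw0 (bb.repr.map_eq_zero_iff.mp (Finsupp.ext hcon))
  rw [eq_top_iff, ← PiTensorProduct.span_tprod_eq_top, Submodule.span_le]
  rintro _ ⟨v, rfl⟩
  -- A tensor product of rank-one maps has rank one: it reads off the coordinate `p`, nonzero on
  -- `w`, and returns a multiple of the arbitrary pure tensor `v`.
  have hrank : PiTensorProduct.map (fun i => ((b i).coord (p i)).smulRight (v i)) =
      (bb.coord p).smulRight (PiTensorProduct.tprod k v) := by
    refine PiTensorProduct.ext (MultilinearMap.ext fun m => ?_)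
    simp only [LinearMap.compMultilinearMap_apply, PiTensorProduct.map_tprod,
      LinearMap.smulRight_apply, Module.Basis.coord_apply]
    rw [Basis.piTensorProduct_repr_tprod_apply, MultilinearMap.map_smul_univ]
  have h1 := hall (fun i => ((b i).coord (p i)).smulRight (v i)) w hw
  rw [hrank, LinearMap.smulRight_apply, Module.Basis.coord_apply] at h1
  exact (N.smul_mem_iff hp).mp h1

end Burnside

/-! ### Action on tensor products, and factors that are lines -/

section TensorRep

attribute [local instance 100] LieRing.ofAssociativeRing

variable {k : Type*} {L : Type*} [Field k] [LieRing L] [LieAlgebra k L]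
variable {ι : Type*} [Fintype ι] {M : ι → Type*} [∀ i, AddCommGroup (M i)] [∀ i, Module k (M i)]

open Classical in
lemma tensorRep_apply (ρ : ∀ i, L →ₗ⁅k⁆ Module.End k (M i)) (x : L) :
    tensorRep ρ x =
      ∑ i, PiTensorProduct.map (Function.update (fun _ => LinearMap.id) i (ρ i x)) := rfl

open Classical in
lemma tensorRep_tprod (ρ : ∀ i, L →ₗ⁅k⁆ Module.End k (M i)) (x : L) (v : ∀ i, M i) :
    tensorRep ρ x (PiTensorProduct.tprod k v) =
      ∑ i, PiTensorProduct.tprod k (Function.update v i (ρ i x (v i))) := by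
  rw [tensorRep_apply, LinearMap.sum_apply]
  refine Finset.sum_congr rfl fun i _ => ?_
  rw [PiTensorProduct.map_tprod]
  congr 1
  funext j
  by_cases hj : j = i
  · subst hj; simp
  · simp [Function.update_of_ne hj]

/-- The action on a tensor product only depends on the operators on the factors. -/
lemma tensorRep_congr {L' : Type*} [LieRing L'] [LieAlgebra k L']
    {ρ : ∀ i, L →ₗ⁅k⁆ Module.End k (M i)} {ρ' : ∀ i, L' →ₗ⁅k⁆ Module.End k (M i)} {x : L} {x' : L'}
    (h : ∀ i, ρ i x = ρ' i x') : tensorRep ρ x = tensorRep ρ' x' := by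
  simp only [tensorRep_apply, h]

open Classical in
lemma tensorRep_eq_single {ρ : ∀ i, L →ₗ⁅k⁆ Module.End k (M i)} {x : L} (i : ι)
    (h : ∀ j, j ≠ i → ρ j x = 0) :
    tensorRep ρ x = PiTensorProduct.map (Function.update (fun _ => LinearMap.id) i (ρ i x)) := by
  rw [tensorRep_apply]
  refine Finset.sum_eq_single i (fun j _ hj => ?_) fun h => (h (Finset.mem_univ _)).elim
  rw [h j hj]
  simpa using PiTensorProduct.map_update_smul (fun _ => LinearMap.id) j (0 : k)
    (0 : M j →ₗ[k] M j)

lemma tensorRep_eq_zero {ρ : ∀ i, L →ₗ⁅k⁆ Module.End k (M i)} {x : L}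
    (h : ∀ i, ρ i x = 0) : tensorRep ρ x = 0 := by
  classical
  rw [tensorRep_apply]
  refine Finset.sum_eq_zero fun i _ => ?_
  rw [h]
  simpa using PiTensorProduct.map_update_smul (fun _ => LinearMap.id) i (0 : k)
    (0 : M i →ₗ[k] M i)

/-- Choose on each factor a functional not vanishing at `v i`; their product does not vanish on the
pure tensor. -/
lemma tprod_ne_zero {v : ∀ i, M i} (hv : ∀ i, v i ≠ 0) : PiTensorProduct.tprod k v ≠ 0 := by
  intro h0
  have hd : ∀ i, ∃ f : Module.Dual k (M i), f (v i) ≠ 0 := fun i => by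
    simpa using (Module.forall_dual_apply_eq_zero_iff k (v i)).not.mpr (hv i)
  choose f hf using hd
  have h1 := PiTensorProduct.dualDistrib_apply f v
  rw [h0, map_zero] at h1
  exact Finset.prod_ne_zero_iff.mpr (fun i _ => hf i) h1.symm

section Slot

variable (v : ∀ i, M i) (i₀ : ι)

open Classical in
/-- If all factors but the `i₀`-th are lines, then `m ↦ v ⊗ ⋯ ⊗ m ⊗ ⋯ ⊗ v` identifies the `i₀`-th
factor with the tensor product. -/
lemma bijective_tprod_update (hv : ∀ i, v i ≠ 0) (h1 : ∀ i, i ≠ i₀ → Module.finrank k (M i) = 1) :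
    Function.Bijective ((PiTensorProduct.tprod k).toLinearMap v i₀) := by
  constructor
  · rw [injective_iff_map_eq_zero]
    intro m hm
    by_contra hne
    refine tprod_ne_zero (k := k) (v := Function.update v i₀ m) (fun i => ?_) hm
    by_cases hi : i = i₀
    · subst hi; simpa using hne
    · simpa [Function.update_of_ne hi] using hv i
  · rw [← LinearMap.range_eq_top, eq_top_iff, ← PiTensorProduct.span_tprod_eq_top,
      Submodule.span_le]
    rintro _ ⟨w, rfl⟩
    have hc : ∀ i, i ≠ i₀ → ∃ c : k, c • v i = w i := fun i hi =>
      (finrank_eq_one_iff_of_nonzero' (v i) (hv i)).mp (h1 i hi) (w i)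
    choose! c hc using hc
    -- The scalars of the one-dimensional slots are collected in front; the value `1` replaces the
    -- meaningless `c i₀`.
    refine ⟨(∏ i, Function.update c i₀ 1 i) • w i₀, ?_⟩
    rw [map_smul, MultilinearMap.toLinearMap_apply, ← MultilinearMap.map_smul_univ]
    congr 1
    funext i
    by_cases hi : i = i₀
    · subst hi; simp
    · simp [Function.update_of_ne hi, hc i hi]

-- Summands other than the `i₀`-th put a zero into some slot, so the identification of the `i₀`-th
-- factor with the tensor product is equivariant.
open Classical in
lemma tensorRep_tprod_update (ρ : ∀ i, L →ₗ⁅k⁆ Module.End k (M i)) (h0 : ∀ i, i ≠ i₀ → ρ i = 0)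
    (x : L) (m : M i₀) :
    tensorRep ρ x ((PiTensorProduct.tprod k).toLinearMap v i₀ m) =
      (PiTensorProduct.tprod k).toLinearMap v i₀ (ρ i₀ x m) := by
  simp only [MultilinearMap.toLinearMap_apply]
  rw [tensorRep_tprod, Finset.sum_eq_single i₀]
  · rw [Function.update_self]
    congr 1
    funext j
    by_cases hj : j = i₀
    · subst hj; simp
    · simp only [Function.update_of_ne hj]
  · intro i _ hi
    refine (PiTensorProduct.tprod k).map_coord_zero i ?_
    simp [h0 i hi]
  · simp

end Slot

end TensorRep

/-! ### Bijective homomorphisms of Lie modules -/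

section LieModuleLemmas

variable {k L M N : Type*} [CommRing k] [LieRing L] [LieAlgebra k L] [AddCommGroup M] [Module k M]
  [LieRingModule L M] [AddCommGroup N] [Module k N] [LieRingModule L N]

/-- A bijective homomorphism of Lie modules is an equivalence. -/
def lieModuleEquivOfBijective (f : M →ₗ⁅k, L⁆ N) (h : Function.Bijective f) : M ≃ₗ⁅k, L⁆ N :=
  { f with
    invFun := (Equiv.ofBijective f h).symm
    left_inv := (Equiv.ofBijective f h).left_inv
    right_inv := (Equiv.ofBijective f h).right_inv }

/-- An injective map into an irreducible module from a nontrivial one is bijective. -/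
lemma bijective_of_injective_of_irreducible [LieModule k L M] [LieModule k L N] [Nontrivial M]
    [LieModule.IsIrreducible k L N]
    (f : M →ₗ⁅k, L⁆ N) (h : Function.Injective f) : Function.Bijective f := by
  refine ⟨h, ?_⟩
  rw [← LieModuleHom.range_eq_top]
  refine (eq_bot_or_eq_top f.range).resolve_left fun hb => ?_
  obtain ⟨m, hm⟩ := exists_ne (0 : M)
  have : f m ∈ f.range := ⟨m, rfl⟩
  rw [hb, LieSubmodule.mem_bot] at this
  exact hm (h (this.trans (map_zero f).symm))

end LieModuleLemmas

/-! ### Sums in `P⁺` with at most one nonzero term -/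

section PPlusLemmas

attribute [local instance 100] LieRing.ofAssociativeRing

variable {k : Type u} {g : Type v} [Field k] [LieRing g] [LieAlgebra k g]

lemma IrrRep.cls_eq_iff {V W : IrrRep k g} : V.cls = W.cls ↔ Nonempty (V.1 ≃ₗ⁅k, g⁆ W.1) :=
  Quotient.eq

lemma PPlus.exists_rep (p : PPlus k g) : ∃ V : IrrRep k g, V.cls = p := Quotient.exists_rep p

instance (V : IrrRep k g) : Nontrivial V.1.carrier :=
  have := V.2
  LieModule.nontrivial_of_isIrreducible k g V.1

lemma IrrRep.rho_eq_zero {V : IrrRep k g} (h : V.cls = 0) : V.1.ρ = 0 := by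
  obtain ⟨e⟩ := IrrRep.cls_eq_iff.mp (show V.cls = (trivRep k g).cls from h)
  refine LieHom.ext fun a => LinearMap.ext fun m => ?_
  refine e.injective ?_
  have h1 := e.toLieModuleHom.map_lie a m
  exact (h1.trans (by rfl)).trans (map_zero e.toLieModuleHom).symm

lemma IrrRep.finrank_eq_one {V : IrrRep k g} (h : V.cls = 0) : Module.finrank k V.1 = 1 := by
  obtain ⟨e⟩ := IrrRep.cls_eq_iff.mp (show V.cls = (trivRep k g).cls from h)
  exact e.toLinearEquiv.finrank_eq.trans (Module.finrank_self k)

/-- A sum in `P⁺` with at most one nonzero term is that term. -/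
lemma IsWeightSum.eq_of_forall_ne {ι : Type*} [Fintype ι] {lam : ι → PPlus k g} {μ : PPlus k g}
    (h : IsWeightSum lam μ) (i₀ : ι) (h0 : ∀ i, i ≠ i₀ → lam i = 0) : μ = lam i₀ := by
  classical
  obtain ⟨V, U, hV, rfl, B, v, -, hv, f, hf, hfe, -⟩ := h
  have hbij := bijective_tprod_update (k := k) v i₀ (fun i => (hv i).1)
    (fun i hi => IrrRep.finrank_eq_one ((hV i).trans (h0 i hi)))
  have heq := tensorRep_tprod_update v i₀ (fun i => (V i).1.ρ)
    (fun i hi => IrrRep.rho_eq_zero ((hV i).trans (h0 i hi)))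
  let e := LinearEquiv.ofBijective _ hbij
  have hU := U.2
  have hV0 := (V i₀).2
  let F : U.1 →ₗ⁅k, g⁆ (V i₀).1 :=
    { toLinearMap := e.symm.toLinearMap ∘ₗ f
      map_lie' := fun {a m} => by
        change e.symm (f ⁅a, m⁆) = ⁅a, e.symm (f m)⁆
        rw [LinearEquiv.symm_apply_eq, hfe, FDMod.lie_def]
        change _ = (PiTensorProduct.tprod k).toLinearMap v i₀ _
        rw [← heq]
        congr 1
        exact (e.apply_symm_apply _).symm }
  rw [← hV i₀, IrrRep.cls_eq_iff]
  exact ⟨lieModuleEquivOfBijective F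
    (bijective_of_injective_of_irreducible F (e.symm.injective.comp hf))⟩

-- Finite dimension gives the ascending chain condition on subalgebras, and the zero subalgebra is
-- solvable.
variable (k g) in
lemma exists_isBorel [FiniteDimensional k g] : ∃ B : LieSubalgebra k g, IsBorel B := by
  have hwf : WellFounded ((· > ·) : LieSubalgebra k g → LieSubalgebra k g → Prop) :=
    wellFounded_gt
  obtain ⟨B, hB, hmax⟩ := hwf.has_min {B : LieSubalgebra k g | LieAlgebra.IsSolvable B}
    ⟨⊥, show LieAlgebra.IsSolvable (⊥ : LieSubalgebra k g) from
      have : IsLieAbelian (⊥ : LieSubalgebra k g) := 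
        ⟨fun x y => Subtype.ext (by simp [(LieSubalgebra.mem_bot (x : g)).mp x.2])⟩
      inferInstance⟩
  exact ⟨B, hB, fun C hC hle => (hle.eq_or_lt).elim (fun h => h.ge) fun h => (hmax C hC h).elim⟩

/-- This is Lie's theorem for the solvable algebra `B` acting on `V`. -/
lemma exists_highestWeightVector [IsAlgClosed k] [CharZero k] {B : LieSubalgebra k g}
    (hB : IsBorel B) (V : IrrRep k g) :
    ∃ v : V.1, v ≠ 0 ∧ ∀ b ∈ B, ∃ c : k, ⁅b, v⁆ = c • v := by
  have : LieAlgebra.IsSolvable B := hB.1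
  obtain ⟨χ, hχ⟩ := LieModule.exists_nontrivial_weightSpace_of_isSolvable k B V.1
  obtain ⟨⟨v, hv⟩, hv0⟩ := exists_ne (0 : LieModule.weightSpace V.1 χ)
  refine ⟨v, fun h => hv0 (Subtype.ext h), fun b hb => ⟨χ ⟨b, hb⟩, ?_⟩⟩
  rw [LieModule.mem_weightSpace] at hv
  exact hv ⟨b, hb⟩

/-- A sum in `P⁺` with at most one nonzero term is that term. -/
lemma weightSum_eq_of_forall_ne [FiniteDimensional k g] [IsAlgClosed k] [CharZero k]
    {ι : Type*} [Fintype ι] {lam : ι → PPlus k g} (i₀ : ι) (h0 : ∀ i, i ≠ i₀ → lam i = 0) :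
    weightSum lam = lam i₀ := by
  classical
  -- Existence is needed separately from uniqueness, since `weightSum` falls back to `0` when no sum
  -- exists.
  have hex : ∃ μ, IsWeightSum lam μ := by
    choose V hV using fun i => PPlus.exists_rep (lam i)
    obtain ⟨B, hB⟩ := exists_isBorel k g
    choose v hv using fun i => exists_highestWeightVector hB (V i)
    have hbij := bijective_tprod_update (k := k) v i₀ (fun i => (hv i).1)
      (fun i hi => IrrRep.finrank_eq_one ((hV i).trans (h0 i hi)))
    have heq := tensorRep_tprod_update v i₀ (fun i => (V i).1.ρ)
      (fun i hi => IrrRep.rho_eq_zero ((hV i).trans (h0 i hi)))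
    -- The embedding is the slot map of the `i₀`-th factor; it is onto, so its range contains the
    -- tensor of the highest weight vectors.
    exact ⟨lam i₀, V, V i₀, hV, hV i₀, B, v, hB, hv, _, hbij.1, fun a m => (heq a m).symm,
      LinearMap.range_eq_top.mpr hbij.2 ▸ trivial⟩
  rw [weightSum, dif_pos hex]
  exact hex.choose_spec.eq_of_forall_ne i₀ h0

end PPlusLemmas

/-! ### The action of `Γ` on `P⁺` -/

section TwistLemmas

variable {k : Type u} {g : Type v} {Γ : Type*} [Field k] [LieRing g] [LieAlgebra k g]
  [Group Γ] [LieMulAction Γ g] [SMulCommClass Γ k g]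

lemma PPlus.smul_zero (γ : Γ) : γ • (0 : PPlus k g) = 0 :=
  IrrRep.cls_eq_iff (V := (trivRep k g).twist γ) (W := trivRep k g).mpr
    ⟨{ (LinearEquiv.refl k k) with map_lie' := fun {_ _} => rfl }⟩

lemma PPlus.mul_smul (γ δ : Γ) (p : PPlus k g) : (γ * δ) • p = γ • δ • p := by
  obtain ⟨V, rfl⟩ := p.exists_rep
  refine IrrRep.cls_eq_iff (V := V.twist (γ * δ)) (W := (V.twist δ).twist γ).mpr
    ⟨{ (LinearEquiv.refl k V.1.carrier) with map_lie' := fun {a m} => ?_ }⟩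
  change V.1.ρ ((γ * δ)⁻¹ • a) m = V.1.ρ (δ⁻¹ • γ⁻¹ • a) m
  rw [mul_inv_rev, SemigroupAction.mul_smul]

lemma PPlus.one_smul (p : PPlus k g) : (1 : Γ) • p = p := by
  obtain ⟨V, rfl⟩ := p.exists_rep
  refine IrrRep.cls_eq_iff (V := V.twist (1 : Γ)) (W := V).mpr
    ⟨{ (LinearEquiv.refl k V.1.carrier) with map_lie' := fun {a m} => ?_ }⟩
  change V.1.ρ ((1 : Γ)⁻¹ • a) m = V.1.ρ a m
  rw [inv_one, _root_.one_smul]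

end TwistLemmas

/-! ### From annihilating constituents to nilpotent action -/

section Nilpotent

attribute [local instance 100] LieRing.ofAssociativeRing

variable {k : Type u} {L : Type v} [Field k] [LieRing L] [LieAlgebra k L]

/-- Every nonzero submodule `N` has a submodule `N'` with irreducible quotient. -/
lemma exists_lt_isConstituent (V : FDMod.{u, v, w} k L) (N : LieSubmodule k L V) (hN : N ≠ ⊥) :
    ∃ N' < N, IsConstituent (FDMod.of (N ⧸ N'.comap N.incl)) V := by
  have hwf : WellFounded ((· > ·) : LieSubmodule k L V → LieSubmodule k L V → Prop) :=
    wellFounded_gt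
  -- `N'` is a maximal proper submodule of `N`; a nonzero submodule `P` of the quotient pulls back
  -- to one strictly above `N'`, hence to `N`.
  obtain ⟨N', (hlt : N' < N), hmax⟩ := hwf.has_min {N' : LieSubmodule k L V | N' < N}
    ⟨⊥, bot_lt_iff_ne_bot.mpr hN⟩
  refine ⟨N', hlt, ?_, N', N, hlt.le, ⟨LieModuleEquiv.refl⟩⟩
  change LieModule.IsIrreducible k L (N ⧸ N'.comap N.incl)
  have : Nontrivial (N ⧸ N'.comap N.incl) := by
    obtain ⟨n, hn, hn'⟩ := SetLike.exists_of_lt hlt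
    refine ⟨LieSubmodule.Quotient.mk ⟨n, hn⟩, 0, fun h => hn' ?_⟩
    rwa [LieSubmodule.Quotient.mk_eq_zero'] at h
  refine LieModule.IsIrreducible.mk fun P hP => ?_
  let P' : LieSubmodule k L V := (P.comap (LieSubmodule.Quotient.mk' (N'.comap N.incl))).map N.incl
  have hmem : ∀ n : N, (n : V) ∈ P' ↔
      (LieSubmodule.Quotient.mk n : N ⧸ N'.comap N.incl) ∈ P := by
    intro n
    constructor
    · intro h
      obtain ⟨n', hn', he⟩ := (LieSubmodule.mem_map _).mp h
      rwa [← (Subtype.ext he : n' = n)]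
    · intro h
      exact (LieSubmodule.mem_map _).mpr ⟨n, h, rfl⟩
  have hle : P' ≤ N := by
    intro m hm
    obtain ⟨n', -, rfl⟩ := (LieSubmodule.mem_map _).mp hm
    exact n'.2
  have hge : N' ≤ P' := by
    intro m hm
    refine (hmem ⟨m, hlt.le hm⟩).mpr ?_
    have : (LieSubmodule.Quotient.mk ⟨m, hlt.le hm⟩ : N ⧸ N'.comap N.incl) = 0 := by
      rw [LieSubmodule.Quotient.mk_eq_zero']; exact hm
    rw [this]
    exact zero_mem _
  have hne : N' ≠ P' := by
    rintro he
    apply hP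
    rw [eq_bot_iff]
    intro q hq
    obtain ⟨n, rfl⟩ := LieSubmodule.Quotient.surjective_mk' _ q
    have h1 := (hmem n).mpr hq
    rw [← he] at h1
    rw [LieSubmodule.mem_bot]
    exact LieSubmodule.Quotient.mk_eq_zero'.mpr h1
  have hPN : P' = N := by
    by_contra hcon
    exact hmax P' (lt_of_le_of_ne hle hcon) (lt_of_le_of_ne hge hne)
  rw [eq_top_iff]
  intro q _
  obtain ⟨n, rfl⟩ := LieSubmodule.Quotient.surjective_mk' _ q
  exact (hmem n).mp (hPN.ge n.2)

/-- If `K` annihilates all irreducible constituents of `V`, then it acts on `V` by strictly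
triangular operators. -/
lemma exists_map_rho_pow_eq_bot (V : FDMod.{u, v, w} k L) (K : Submodule k L)
    (hK : ∀ S : FDMod.{u, v, w} k L, IsConstituent S V → ∀ a ∈ K, ∀ m : S, ⁅a, m⁆ = 0) :
    ∃ n, (K.map (V.ρ : L →ₗ[k] Module.End k V.carrier)) ^ n = ⊥ := by
  suffices h : ∀ N : LieSubmodule k L V,
      ∃ n, ∀ e ∈ (K.map (V.ρ : L →ₗ[k] Module.End k V.carrier)) ^ n, ∀ m ∈ N, e m = 0 by
    obtain ⟨n, hn⟩ := h ⊤
    exact ⟨n, eq_bot_iff.mpr fun e he => LinearMap.ext fun m => hn e he m trivial⟩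
  intro N
  have : WellFoundedLT (LieSubmodule k L V) := LieSubmodule.wellFoundedLT_of_isArtinian k L V
  induction N using WellFoundedLT.induction with
  | ind N ih =>
    by_cases hN : N = ⊥
    · subst hN
      exact ⟨0, fun e _ m hm => by rw [(LieSubmodule.mem_bot m).mp hm, map_zero]⟩
    obtain ⟨N', hlt, hS⟩ := exists_lt_isConstituent V N hN
    obtain ⟨n, hn⟩ := ih N' hlt
    -- The rightmost factor maps `N` into `N'`, because it kills the irreducible quotient; the
    -- remaining `n` factors kill `N'`.
    refine ⟨n + 1, fun e he m hm => ?_⟩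
    rw [pow_succ] at he
    induction he using Submodule.mul_induction_on' with
    | mem_mul_mem e he f hf =>
      obtain ⟨a, ha, rfl⟩ := hf
      refine hn e he _ ?_
      have h1 : ⁅a, (LieSubmodule.Quotient.mk ⟨m, hm⟩ : N ⧸ N'.comap N.incl)⁆ = 0 :=
        hK _ hS a ha _
      have h2 : ⁅a, (⟨m, hm⟩ : N)⁆ ∈ N'.comap N.incl := LieSubmodule.Quotient.mk_eq_zero'.mp h1
      exact h2
    | add e _ f _ h1 h2 => rw [LinearMap.add_apply, h1, h2, add_zero]

/-- If `K (n + 2) ⊆ [K 1, K (n + 1)]` for all `n` and `K 1` annihilates all irreducible constituents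
of `V`, then some `K (n + 1)` annihilates `V`. -/
lemma exists_forall_rho_eq_zero (V : FDMod.{u, v, w} k L) (K : ℕ → Submodule k L)
    (hspan : ∀ n, K (n + 2) ≤ Submodule.span k {c | ∃ a ∈ K 1, ∃ b ∈ K (n + 1), ⁅a, b⁆ = c})
    (hK : ∀ S : FDMod.{u, v, w} k L, IsConstituent S V → ∀ a ∈ K 1, ∀ m : S, ⁅a, m⁆ = 0) :
    ∃ n, ∀ a ∈ K (n + 1), V.ρ a = 0 := by
  obtain ⟨n, hn⟩ := exists_map_rho_pow_eq_bot V (K 1) hK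
  -- A bracket acts as a difference of two products, each with one more factor from `K 1`. Indices
  -- start at `1`, as nothing is assumed about `K 0`.
  have hle : ∀ n, (K (n + 1)).map (V.ρ : L →ₗ[k] Module.End k V.carrier) ≤
      ((K 1).map (V.ρ : L →ₗ[k] Module.End k V.carrier)) ^ (n + 1) := by
    intro n
    induction n with
    | zero => rw [zero_add, pow_one]
    | succ n ih =>
      refine (Submodule.map_mono (hspan n)).trans ?_
      rw [Submodule.map_span_le]
      rintro _ ⟨a, ha, b, hb, rfl⟩
      have ha' := Submodule.mem_map_of_mem (f := (V.ρ : L →ₗ[k] Module.End k V.carrier)) ha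
      have hb' := ih (Submodule.mem_map_of_mem hb)
      change V.ρ ⁅a, b⁆ ∈ _
      rw [LieHom.map_lie, Ring.lie_def]
      refine sub_mem ?_ ?_
      · rw [pow_succ']; exact Submodule.mul_mem_mul ha' hb'
      · rw [pow_succ]; exact Submodule.mul_mem_mul hb' ha'
  refine ⟨n, fun a ha => ?_⟩
  have h1 := hle n (Submodule.mem_map_of_mem ha)
  rw [pow_succ, hn, Submodule.bot_mul, Submodule.mem_bot] at h1
  exact h1

end Nilpotent

/-! ### Semisimple Lie algebras are perfect -/

section Perfect

variable (k g : Type*) [Field k] [LieRing g] [LieAlgebra k g] [LieAlgebra.IsSemisimple k g]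

/-- A semisimple Lie algebra is perfect. -/
lemma span_lie_eq_top :
    Submodule.span k {c : g | ∃ a b : g, ⁅a, b⁆ = c} = ⊤ := by
  have h : (⊤ : LieIdeal k g) ≤ ⁅(⊤ : LieIdeal k g), (⊤ : LieIdeal k g)⁆ := by
    rw [← LieAlgebra.IsSemisimple.sSup_atoms_eq_top (R := k) (L := g), sSup_le_iff]
    intro I hI
    -- A minimal ideal `I` is not abelian, so `⁅I, I⁆` is nonzero and equals `I`; such ideals
    -- generate `g`.
    have hle : ⁅I, I⁆ ≤ I := LieSubmodule.lie_le_right I I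
    rw [LieAlgebra.IsSemisimple.sSup_atoms_eq_top]
    rcases hI.le_iff.mp hle with h0 | h1
    · refine absurd ?_ (LieAlgebra.IsSemisimple.non_abelian_of_isAtom I hI)
      exact (LieSubmodule.lie_abelian_iff_lie_self_eq_bot I).mpr h0
    · exact h1.ge.trans (LieSubmodule.mono_lie le_top le_top)
  rw [eq_top_iff]
  intro u _
  have hu : u ∈ (⁅(⊤ : LieIdeal k g), (⊤ : LieIdeal k g)⁆ : LieIdeal k g) := h trivial
  rw [← LieSubmodule.mem_toSubmodule, LieSubmodule.lieIdeal_oper_eq_linear_span'] at hu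
  refine Submodule.span_mono ?_ hu
  rintro _ ⟨a, -, b, -, rfl⟩
  exact ⟨a, b, rfl⟩

end Perfect

/-! ### The subspaces `g ⊗ I`, and annihilators of modules in `𝓕_x` -/

section TensorIdeal

attribute [local instance 100] LieRing.ofAssociativeRing

variable {k : Type u} {A : Type*} {g : Type*} [Field k] [CommRing A] [Algebra k A]
  [LieRing g] [LieAlgebra k g]

lemma tmul_mem_tensorIdeal {I : Ideal A} {a : A} (ha : a ∈ I) (u : g) :
    a ⊗ₜ[k] u ∈ tensorIdeal g I := by
  have : a ⊗ₜ[k] u = a • ((1 : A) ⊗ₜ[k] u) := by rw [TensorProduct.smul_tmul', smul_eq_mul, mul_one]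
  rw [this]
  exact Submodule.smul_mem_smul ha trivial

lemma tensorIdeal_mono {I J : Ideal A} (h : I ≤ J) :
    (tensorIdeal g I : Submodule A (A ⊗[k] g)) ≤ tensorIdeal g J :=
  Submodule.smul_mono_left h

@[elab_as_elim]
lemma tensorIdeal_induction {I : Ideal A} {motive : A ⊗[k] g → Prop} {α : A ⊗[k] g}
    (hα : α ∈ tensorIdeal g I) (tmul : ∀ a ∈ I, ∀ u : g, motive (a ⊗ₜ u)) (zero : motive 0)
    (add : ∀ α β, motive α → motive β → motive (α + β)) : motive α := by
  refine Submodule.smul_induction_on hα (fun a ha β _ => ?_) add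
  induction β with
  | zero => simpa using zero
  | add β₁ β₂ h₁ h₂ => rw [smul_add]; exact add _ _ (h₁ trivial) (h₂ trivial)
  | tmul b u =>
    rw [TensorProduct.smul_tmul', smul_eq_mul]
    exact tmul _ (I.mul_mem_right b ha) u

lemma evalAt_tmul (y : RatPt k A) (a : A) (u : g) : evalAt y (a ⊗ₜ[k] u) = y.eval a • u := rfl

lemma evalAt_eq_zero {I : Ideal A} {y : RatPt k A} (h : I ≤ y.maxIdeal) {α : A ⊗[k] g}
    (hα : α ∈ tensorIdeal g I) : evalAt y α = 0 := by
  refine tensorIdeal_induction hα (fun a ha u => ?_) (map_zero _) fun α β h1 h2 => ?_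
  · have h1 : y.eval a = 0 := h ha
    rw [evalAt_tmul, h1, zero_smul]
  · rw [map_add, h1, h2, add_zero]

/-- `α` annihilates an evaluation representation if it vanishes at all the points. -/
lemma IsEvalRep.lie_eq_zero {L : Type*} [LieRing L] [LieAlgebra k L]
    {ev : RatPt k A → (L →ₗ⁅k⁆ g)} {s : Finset (RatPt k A)} {ψ : RatPt k A → PPlus k g}
    {V : FDMod.{u, _, w} k L} (hV : IsEvalRep ev s ψ V) {α : L} (hα : ∀ y ∈ s, ev y α = 0)
    (m : V) : ⁅α, m⁆ = 0 := by
  obtain ⟨R, -, φ, hφ⟩ := hV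
  refine φ.injective ?_
  have h0 := tensorRep_eq_zero (ρ := fun y : s => ((R y).1.pullback (ev y)).ρ) (x := α) fun y => by
    change (R y).1.ρ (ev y α) = 0
    rw [hα y y.2, map_zero]
  exact ((hφ α m).trans (LinearMap.congr_fun h0 (φ m))).trans (map_zero φ).symm

/-- `(g ⊗ I J)` is spanned by the brackets of `g ⊗ I` and `g ⊗ J`. -/
lemma tensorIdeal_mul_induction [LieAlgebra.IsSemisimple k g] {I J : Ideal A}
    {motive : A ⊗[k] g → Prop} {α : A ⊗[k] g}
    (hα : α ∈ tensorIdeal g (I * J))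
    (lie : ∀ a ∈ I, ∀ b ∈ J, ∀ u v : g, motive ⁅a ⊗ₜ[k] u, b ⊗ₜ[k] v⁆) (zero : motive 0)
    (add : ∀ α β, motive α → motive β → motive (α + β)) : motive α := by
  refine tensorIdeal_induction hα (fun c hc w => ?_) zero add
  have hw : w ∈ Submodule.span k {c : g | ∃ a b : g, ⁅a, b⁆ = c} := by
    rw [span_lie_eq_top]; trivial
  induction hc using Submodule.mul_induction_on' with
  | mem_mul_mem a ha b hb =>
    -- By perfectness `w` is a combination of brackets, and `(a b) ⊗ [u, v] = [a ⊗ u, b ⊗ v]`.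
    -- Scalars are moved into `a`, so `a` has to vary.
    induction hw using Submodule.span_induction generalizing a with
    | mem w hw =>
      obtain ⟨u, v, rfl⟩ := hw
      simpa only [LieAlgebra.ExtendScalars.bracket_tmul] using lie a ha b hb u v
    | zero => simpa using zero
    | add w₁ w₂ _ _ h1 h2 => rw [TensorProduct.tmul_add]; exact add _ _ (h1 a ha) (h2 a ha)
    | smul t w _ h1 =>
      rw [← TensorProduct.smul_tmul, ← smul_mul_assoc]
      refine h1 (t • a) ?_
      rw [Algebra.smul_def]
      exact I.mul_mem_left _ ha
  | add a _ b _ h1 h2 => rw [TensorProduct.add_tmul]; exact add _ _ h1 h2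

/-- The exponent function equal to `n` on `x` and `0` elsewhere. -/
def constExp (x : Finset (RatPt k A)) (n : ℕ) : RatPt k A →₀ ℕ := Finsupp.indicator x fun _ _ => n

lemma constExp_support (x : Finset (RatPt k A)) (n : ℕ) : (constExp x n).support ⊆ x :=
  Finsupp.support_indicator_subset _ _

/-- Uniform exponents turn `I_η` into a power of one ideal, the form in which nilpotency delivers
annihilators. -/
lemma powIdeal_constExp (x : Finset (RatPt k A)) (n : ℕ) :
    powIdeal (constExp x n) = (∏ y ∈ x, y.maxIdeal) ^ n := by
  classical
  rw [powIdeal, Finsupp.prod_of_support_subset _ (constExp_support x n) _ (fun _ _ => pow_zero _),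
    ← Finset.prod_pow]
  refine Finset.prod_congr rfl fun y hy => ?_
  rw [constExp, Finsupp.indicator_of_mem hy]

lemma powIdeal_add (η η' : RatPt k A →₀ ℕ) : powIdeal (η + η') = powIdeal η * powIdeal η' := by
  classical
  exact Finsupp.prod_add_index' (fun _ => pow_zero _) (fun _ _ _ => pow_add _ _ _)

lemma prod_maxIdeal_le {x : Finset (RatPt k A)} {y : RatPt k A} (hy : y ∈ x) :
    ∏ z ∈ x, z.maxIdeal ≤ y.maxIdeal :=
  Ideal.prod_le_inf.trans (Finset.inf_le hy)

/-- Modules in `𝓕_x` are annihilated by `g ⊗ I_η` for some `η` supported in `x`. -/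
theorem FX.exists_annihilates [LieAlgebra.IsSemisimple k g] {x : Finset (RatPt k A)}
    {V : FDMod.{u, _, w} k (A ⊗[k] g)} (hV : FX g x V) :
    ∃ η : RatPt k A →₀ ℕ, η.support ⊆ x ∧ ∀ α ∈ tensorIdeal g (powIdeal η), V.ρ α = 0 := by
  suffices h : ∃ n, ∀ α ∈ (tensorIdeal g ((∏ y ∈ x, y.maxIdeal) ^ (n + 1))).restrictScalars k,
      V.ρ α = 0 by
    obtain ⟨n, hn⟩ := h
    exact ⟨constExp x (n + 1), constExp_support x _, by rwa [powIdeal_constExp]⟩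
  refine exists_forall_rho_eq_zero V
    (fun n => (tensorIdeal g ((∏ y ∈ x, y.maxIdeal) ^ n)).restrictScalars k) (fun n α hα => ?_)
    (fun S hS α hα m => ?_)
  · rw [Submodule.restrictScalars_mem, pow_succ'] at hα
    refine tensorIdeal_mul_induction hα (fun a ha b hb u v => ?_) (zero_mem _)
      fun α β h1 h2 => add_mem h1 h2
    refine Submodule.subset_span ⟨_, ?_, _, tmul_mem_tensorIdeal hb v, rfl⟩
    rw [pow_one]
    exact tmul_mem_tensorIdeal ha u
  · obtain ⟨ψ, -, ⟨s, hs, hev⟩, hψ⟩ := hV S hS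
    rw [pow_one, Submodule.restrictScalars_mem] at hα
    refine hev.lie_eq_zero (fun y hy => evalAt_eq_zero (prod_maxIdeal_le ?_) hα) m
    exact hψ (hs ▸ hy)

end TensorIdeal

/-! ### Free actions on rational points are Galois -/

section Galois

variable {k : Type u} {A : Type*} {Γ : Type*} [Field k] [CommRing A] [Algebra k A]
  [Group Γ] [MulSemiringAction Γ A] [SMulCommClass Γ k A]

/-- Over an algebraically closed field, every maximal ideal of a finitely generated algebra is that
of a rational point. -/
lemma exists_maxIdeal_eq [IsAlgClosed k] [Algebra.FiniteType k A] (M : Ideal A) (hM : M.IsMaximal) :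
    ∃ y : RatPt k A, y.maxIdeal = M := by
  let := Ideal.Quotient.field M
  -- Nullstellensatz: the residue field is finite over the algebraically closed field `k`, hence
  -- equal to it.
  have : Module.Finite k (A ⧸ M) := finite_of_finite_type_of_isJacobsonRing k (A ⧸ M)
  have hbij : Function.Bijective (algebraMap k (A ⧸ M)) :=
    IsAlgClosed.algebraMap_bijective_of_isIntegral
  let e : k ≃ₐ[k] A ⧸ M := AlgEquiv.ofBijective (Algebra.ofId k (A ⧸ M)) hbij
  let y : A →ₐ[k] k := e.symm.toAlgHom.comp (Ideal.Quotient.mkₐ k M)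
  refine ⟨y, Ideal.ext fun a => ?_⟩
  change e.symm (Ideal.Quotient.mk M a) = 0 ↔ _
  rw [map_eq_zero_iff e.symm e.symm.injective, Ideal.Quotient.eq_zero_iff_mem]

variable (A Γ) in
/-- The `A`-span of the functions `γ ↦ γ • b`. -/
def conjSpan : Submodule A (Γ → A) := Submodule.span A (Set.range fun (b : A) (γ : Γ) => γ • b)

lemma conj_mem_conjSpan (b : A) : (fun γ : Γ => γ • b) ∈ conjSpan A Γ :=
  Submodule.subset_span ⟨b, rfl⟩

lemma one_mem_conjSpan : (1 : Γ → A) ∈ conjSpan A Γ := by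
  convert conj_mem_conjSpan (Γ := Γ) (1 : A) using 1
  funext γ
  simp

/-- The generators are closed under multiplication, since `Γ` acts by ring automorphisms. -/
lemma mul_mem_conjSpan {F G : Γ → A} (hF : F ∈ conjSpan A Γ) (hG : G ∈ conjSpan A Γ) :
    F * G ∈ conjSpan A Γ := by
  have h := Submodule.mul_mem_mul hF hG
  rw [conjSpan, Submodule.span_mul_span] at h
  refine Submodule.span_mono ?_ h
  rintro _ ⟨_, ⟨b, rfl⟩, _, ⟨c, rfl⟩, rfl⟩
  exact ⟨b * c, funext fun γ => smul_mul' γ b c⟩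

open Classical in
/-- A free action on the rational points is Galois: there are `a i`, `b i` in `A` such that
`∑ a i * γ • b i` is `1` for `γ = 1` and `0` otherwise. -/
theorem single_mem_conjSpan [IsAlgClosed k] [Algebra.FiniteType k A] [Fintype Γ]
    (hfree : ActsFreely Γ k A) : Pi.single 1 1 ∈ conjSpan A Γ := by
  have hsep : ∀ γ : Γ, γ ≠ 1 → ∃ F ∈ conjSpan A Γ, F 1 = 1 ∧ F γ = 0 := by
    intro γ hγ
    -- If all `b - γ • b` vanished at a rational point `y`, then `γ⁻¹` would fix `y`, against
    -- freeness.
    have htop : Ideal.span (Set.range fun b : A => b - γ • b) = ⊤ := by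
      by_contra hne
      obtain ⟨M, hM, hle⟩ := Ideal.exists_le_maximal _ hne
      obtain ⟨y, rfl⟩ := exists_maxIdeal_eq (k := k) M hM
      refine hγ (inv_eq_one.mp (hfree γ⁻¹ y (RatPt.ext fun a => ?_)))
      have h1 : y.eval (a - γ • a) = 0 := hle (Ideal.subset_span ⟨a, rfl⟩)
      rw [RatPt.smul_eval, inv_inv]
      rw [map_sub, sub_eq_zero] at h1
      exact h1.symm
    suffices h : ∀ a ∈ Ideal.span (Set.range fun b : A => b - γ • b),
        ∃ F ∈ conjSpan A Γ, F 1 = a ∧ F γ = 0 from h 1 (htop ▸ trivial)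
    intro a ha
    induction ha using Submodule.span_induction with
    | mem a ha =>
      obtain ⟨b, rfl⟩ := ha
      -- The function `δ ↦ δ • b - γ • b` has value `b - γ • b` at `1` and `0` at `γ`.
      refine ⟨_, sub_mem (conj_mem_conjSpan b) (Submodule.smul_mem _ (γ • b) one_mem_conjSpan),
        ?_, ?_⟩ <;> simp
    | zero => exact ⟨0, zero_mem _, rfl, rfl⟩
    | add a b _ _ h1 h2 =>
      obtain ⟨F, hF, h1, h1'⟩ := h1
      obtain ⟨G, hG, h2, h2'⟩ := h2
      exact ⟨F + G, add_mem hF hG, by simp [h1, h2], by simp [h1', h2']⟩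
    | smul c a _ h1 =>
      obtain ⟨F, hF, h1, h1'⟩ := h1
      exact ⟨c • F, Submodule.smul_mem _ c hF, by simp [h1], by simp [h1']⟩
  choose! F hF h1 h0 using hsep
  -- Multiplying the functions that separate `1` from each `γ ≠ 1` gives the indicator of `1`.
  have hprod : (∏ γ ∈ Finset.univ.erase (1 : Γ), F γ) ∈ conjSpan A Γ :=
    Finset.prod_induction _ (· ∈ conjSpan A Γ) (fun _ _ => mul_mem_conjSpan) one_mem_conjSpan
      fun γ hγ => hF γ (Finset.ne_of_mem_erase hγ)
  convert hprod using 1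
  funext δ
  rw [Finset.prod_apply]
  by_cases hδ : δ = 1
  · subst hδ
    rw [Pi.single_eq_same]
    exact (Finset.prod_eq_one fun γ hγ => h1 γ (Finset.ne_of_mem_erase hγ)).symm
  · rw [Pi.single_eq_of_ne hδ]
    exact (Finset.prod_eq_zero (f := fun γ => F γ δ) (Finset.mem_erase.mpr ⟨hδ, Finset.mem_univ _⟩)
      (h0 δ hδ)).symm

end Galois

/-! ### The trace onto fixed points, and brackets of fixed elements -/

section Trace

variable {k : Type u} {A : Type*} {g : Type*} {Γ : Type*} [Field k] [CommRing A] [Algebra k A]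
  [LieRing g] [LieAlgebra k g] [Group Γ] [MulSemiringAction Γ A] [SMulCommClass Γ k A]
  [LieMulAction Γ g] [SMulCommClass Γ k g]

variable (k A g Γ) in
/-- The trace map `α ↦ ∑ γ α` from `g ⊗ A` to `(g ⊗ A)^Γ`. -/
def traceMap [Fintype Γ] : A ⊗[k] g →ₗ[k] EMA k A g Γ :=
  LinearMap.codRestrict (EMA k A g Γ).toSubmodule (∑ γ : Γ, diag k A g γ) fun α δ => by
    simp only [LinearMap.sum_apply, map_sum, diag_diag]
    exact Fintype.sum_equiv (Equiv.mulLeft δ) _ _ fun _ => rfl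

lemma coe_traceMap [Fintype Γ] (α : A ⊗[k] g) :
    (traceMap k A g Γ α : A ⊗[k] g) = ∑ γ : Γ, diag k A g γ α :=
  LinearMap.sum_apply _ _ _

/-- In characteristic zero this makes the trace surjective onto fixed points, as `|Γ|` is
invertible. -/
lemma traceMap_coe [Fintype Γ] (α : EMA k A g Γ) :
    traceMap k A g Γ α = (Fintype.card Γ : k) • α := by
  refine Subtype.ext ?_
  rw [coe_traceMap, Finset.sum_congr rfl fun γ _ => α.2 γ, Finset.sum_const, Finset.card_univ,
    ← Nat.cast_smul_eq_nsmul k]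
  rfl

/-- Projection formula: the diagonal action preserves brackets and fixes `β`, so `β` comes out of
the sum. -/
lemma traceMap_lie_coe [Fintype Γ] (α : A ⊗[k] g) (β : EMA k A g Γ) :
    traceMap k A g Γ ⁅α, (β : A ⊗[k] g)⁆ = ⁅traceMap k A g Γ α, β⁆ := by
  refine Subtype.ext ?_
  rw [LieSubalgebra.coe_bracket, coe_traceMap, coe_traceMap, sum_lie]
  refine Finset.sum_congr rfl fun γ _ => ?_
  rw [diag_lie, β.2 γ]

lemma diag_mem_tensorIdeal {I J : Ideal A} {γ : Γ} (h : ∀ a ∈ I, γ • a ∈ J) {α : A ⊗[k] g}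
    (hα : α ∈ tensorIdeal g I) : diag k A g γ α ∈ tensorIdeal g J := by
  refine tensorIdeal_induction hα (fun a ha u => ?_) ?_ fun α β h1 h2 => ?_
  · rw [diag_tmul]; exact tmul_mem_tensorIdeal (h a ha) _
  · rw [map_zero]; exact zero_mem _
  · rw [map_add]; exact add_mem h1 h2

lemma traceMap_mem_tensorIdeal [Fintype Γ] {I : Ideal A} (h : ∀ (γ : Γ), ∀ a ∈ I, γ • a ∈ I)
    {α : A ⊗[k] g} (hα : α ∈ tensorIdeal g I) :
    (traceMap k A g Γ α : A ⊗[k] g) ∈ tensorIdeal g I := by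
  rw [coe_traceMap]
  exact sum_mem fun γ _ => diag_mem_tensorIdeal (h γ) hα

variable (g Γ) in
/-- The subspace `(g ⊗ I)^Γ` of `(g ⊗ A)^Γ`. -/
def fixedIdeal (I : Ideal A) : Submodule k (EMA k A g Γ) :=
  ((tensorIdeal g I).restrictScalars k).comap (EMA k A g Γ).toSubmodule.subtype

/-- For `Γ`-stable ideals `I` and `J`, `(g ⊗ I J)^Γ` is spanned by the brackets of `(g ⊗ I)^Γ` and
`(g ⊗ J)^Γ`. -/
theorem fixedIdeal_mul_le [IsAlgClosed k] [CharZero k] [Algebra.FiniteType k A]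
    [LieAlgebra.IsSemisimple k g] [Fintype Γ] (hfree : ActsFreely Γ k A) {I J : Ideal A}
    (hI : ∀ (γ : Γ), ∀ a ∈ I, γ • a ∈ I) (hJ : ∀ (γ : Γ), ∀ a ∈ J, γ • a ∈ J) :
    fixedIdeal g Γ (I * J) ≤ Submodule.span k
      {c | ∃ a ∈ fixedIdeal (k := k) g Γ I, ∃ b ∈ fixedIdeal (k := k) g Γ J, ⁅a, b⁆ = c} := by
  classical
  set D := Submodule.span k
    {c | ∃ a ∈ fixedIdeal (k := k) g Γ I, ∃ b ∈ fixedIdeal (k := k) g Γ J, ⁅a, b⁆ = c} with hD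
  suffices h : ∀ β ∈ tensorIdeal g (I * J), traceMap k A g Γ β ∈ D by
    intro α hα
    have h1 := h α hα
    rw [traceMap_coe] at h1
    exact (D.smul_mem_iff (Nat.cast_ne_zero.mpr Fintype.card_ne_zero)).mp h1
  intro β hβ
  refine tensorIdeal_mul_induction (motive := fun β => traceMap k A g Γ β ∈ D) hβ
    (fun c hc d hd u v => ?_) ?_ fun α β h1 h2 => ?_
  -- For `F δ = δ • b` the sum is `[c ⊗ u, tr(b d ⊗ v)]`, whose trace is a bracket of two traces.
  -- Coefficients from `A` are absorbed into `c`, which therefore varies over `I`.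
  · have key : ∀ F ∈ conjSpan A Γ, ∀ c ∈ I, traceMap k A g Γ
        (∑ δ : Γ, F δ • ⁅c ⊗ₜ[k] u, diag k A g δ (d ⊗ₜ[k] v)⁆) ∈ D := by
      intro F hF
      induction hF using Submodule.span_induction with
      | mem F hF =>
        obtain ⟨b, rfl⟩ := hF
        intro c hc
        have h1 : ∑ δ : Γ, (δ • b) • ⁅c ⊗ₜ[k] u, diag k A g δ (d ⊗ₜ[k] v)⁆ =
            ⁅c ⊗ₜ[k] u, (traceMap k A g Γ ((b * d) ⊗ₜ[k] v) : A ⊗[k] g)⁆ := by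
          rw [coe_traceMap, lie_sum]
          refine Finset.sum_congr rfl fun δ _ => ?_
          rw [← lie_smul, diag_tmul, diag_tmul, smul_mul', TensorProduct.smul_tmul', smul_eq_mul]
        rw [h1, traceMap_lie_coe]
        refine Submodule.subset_span ⟨_, ?_, _, ?_, rfl⟩
        · exact traceMap_mem_tensorIdeal hI (tmul_mem_tensorIdeal hc u)
        · exact traceMap_mem_tensorIdeal hJ (tmul_mem_tensorIdeal (J.mul_mem_left b hd) v)
      | zero => intro c hc; simp
      | add F G _ _ h1 h2 =>
        intro c hc
        simp only [Pi.add_apply, add_smul, Finset.sum_add_distrib, map_add]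
        exact add_mem (h1 c hc) (h2 c hc)
      | smul a F _ h1 =>
        intro c hc
        convert h1 (a * c) (I.mul_mem_left a hc) using 3 with δ
        rw [← smul_eq_mul a c, ← TensorProduct.smul_tmul', smul_lie, smul_smul, Pi.smul_apply,
          smul_eq_mul, mul_comm]
    -- For the indicator of `1` only the term `δ = 1` survives, which is the bracket wanted.
    have h1 := key _ (single_mem_conjSpan hfree) c hc
    rwa [Finset.sum_eq_single 1 (fun δ _ hδ => by rw [Pi.single_eq_of_ne hδ, zero_smul])
      (fun h => (h (Finset.mem_univ _)).elim), Pi.single_eq_same, one_smul, diag_one] at h1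
  · rw [map_zero]; exact zero_mem _
  · rw [map_add]; exact add_mem h1 h2

end Trace

/-! ### Annihilators of modules in `𝓕^Γ_x` -/

section Annihilation

variable {k : Type u} {A : Type*} {g : Type*} {Γ : Type*} [Field k] [CommRing A] [Algebra k A]
  [LieRing g] [LieAlgebra k g] [Group Γ] [MulSemiringAction Γ A] [SMulCommClass Γ k A]
  [LieMulAction Γ g] [SMulCommClass Γ k g]

variable (Γ) in
/-- The ideal of functions vanishing on `Γ · x`. -/
def orbitIdeal (x : Finset (RatPt k A)) : Ideal A :=
  ⨅ z ∈ orbits Γ (x : Set (RatPt k A)), z.maxIdeal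

lemma mem_orbitIdeal {x : Finset (RatPt k A)} {a : A} :
    a ∈ orbitIdeal Γ x ↔ ∀ z ∈ orbits Γ (x : Set (RatPt k A)), z.eval a = 0 := by
  simp only [orbitIdeal, Submodule.mem_iInf]
  rfl

lemma smul_mem_orbitIdeal {x : Finset (RatPt k A)} (γ : Γ) {a : A} (ha : a ∈ orbitIdeal Γ x) :
    γ • a ∈ orbitIdeal Γ x := by
  rw [mem_orbitIdeal] at ha ⊢
  rintro z ⟨δ, y, hy, rfl⟩
  have h1 := ha (γ⁻¹ • δ • y) ⟨γ⁻¹ * δ, y, hy, (mul_smul _ _ _).symm⟩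
  rwa [RatPt.smul_eval, inv_inv] at h1

lemma smul_mem_pow {I : Ideal A} (h : ∀ (γ : Γ), ∀ a ∈ I, γ • a ∈ I) (n : ℕ) (γ : Γ) (a : A)
    (ha : a ∈ I ^ n) : γ • a ∈ I ^ n := by
  have h1 : I ≤ I.comap (MulSemiringAction.toRingHom Γ A γ) := fun a ha => h γ a ha
  exact Ideal.le_comap_pow _ n (Ideal.pow_right_mono h1 n ha)

/-- For pairwise coprime ideals, `⋂ (g ⊗ I i) = g ⊗ ∏ I i`. -/
lemma mem_tensorIdeal_prod {ι : Type*} {s : Finset ι} {I : ι → Ideal A}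
    (hI : ∀ i ∈ s, ∀ j ∈ s, i ≠ j → I i ⊔ I j = ⊤) {α : A ⊗[k] g}
    (hα : ∀ i ∈ s, α ∈ tensorIdeal g (I i)) : α ∈ tensorIdeal g (∏ i ∈ s, I i) := by
  classical
  induction s using Finset.induction_on with
  | empty =>
    rw [Finset.prod_empty, tensorIdeal, Ideal.one_eq_top, Submodule.top_smul]
    trivial
  | insert i s his ih =>
    rw [Finset.prod_insert his]
    have h1 := hα i (Finset.mem_insert_self i s)
    have h2 := ih (fun i hi j hj => hI i (Finset.mem_insert_of_mem hi) j
      (Finset.mem_insert_of_mem hj)) fun i hi => hα i (Finset.mem_insert_of_mem hi)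
    have hcop : I i ⊔ ∏ j ∈ s, I j = ⊤ := Ideal.sup_prod_eq_top fun j hj =>
      hI i (Finset.mem_insert_self i s) j (Finset.mem_insert_of_mem hj)
        fun h => his (h ▸ hj)
    obtain ⟨e, he, f, hf, hef⟩ := Submodule.mem_sup.mp ((Ideal.eq_top_iff_one _).mp hcop)
    -- Write `α = e α + f α`. Each term has its scalar in one of the two coprime ideals, while `α`
    -- has coefficients in the other.
    rw [← one_smul A α, ← hef, add_smul, tensorIdeal]
    refine add_mem ?_ ?_
    · rw [← smul_eq_mul, Submodule.smul_assoc]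
      exact Submodule.smul_mem_smul he h2
    · rw [mul_comm, ← smul_eq_mul, Submodule.smul_assoc]
      exact Submodule.smul_mem_smul hf h1

/-- `(g ⊗ I_η)^Γ ⊆ g ⊗ J ^ n`, for `J` the ideal of `Γ · x` and `η` equal to `n` on `x`. -/
lemma mem_tensorIdeal_orbitIdeal_pow [Fintype Γ] (hfree : ActsFreely Γ k A)
    {x : Finset (RatPt k A)} (hx : x ∈ XStar Γ k A) (n : ℕ) {α : EMA k A g Γ}
    (hα : (α : A ⊗[k] g) ∈ tensorIdeal g (powIdeal (constExp x n))) :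
    (α : A ⊗[k] g) ∈ tensorIdeal g (orbitIdeal Γ x ^ n) := by
  classical
  set I := powIdeal (constExp x n) with hIdef
  set Q : Ideal A := ∏ y ∈ x, y.maxIdeal with hQ
  have hIQ : I = Q ^ n := powIdeal_constExp x n
  let c : Γ → Ideal A → Ideal A := fun γ I => I.comap (MulSemiringAction.toRingHom Γ A γ)
  have hmem : ∀ γ a (I : Ideal A), a ∈ c γ I ↔ γ • a ∈ I := fun γ a I => Iff.rfl
  have hcop : ∀ γ ∈ (Finset.univ : Finset Γ), ∀ δ ∈ (Finset.univ : Finset Γ), γ ≠ δ →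
      c γ I ⊔ c δ I = ⊤ := by
    intro γ _ δ _ hne
    -- Coprimality of `I` with its pull-back along `δ * γ⁻¹` is transported by `γ⁻¹`.
    have h1 := coprime_translate hfree hx (constExp_support x n) (γ := δ * γ⁻¹)
      fun h => hne (mul_inv_eq_one.mp h).symm
    obtain ⟨e, he, f, hf, hef⟩ := Submodule.mem_sup.mp ((Ideal.eq_top_iff_one _).mp h1)
    rw [Ideal.eq_top_iff_one]
    refine Submodule.mem_sup.mpr ⟨γ⁻¹ • e, ?_, γ⁻¹ • f, ?_, ?_⟩
    · rwa [hmem, smul_inv_smul]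
    · rw [hmem, ← mul_smul]; exact hf
    · rw [← smul_add, hef, smul_one]
  -- A fixed element equals all its translates, so it lies in `g ⊗ c γ I` for every `γ`; coprimality
  -- passes to the product.
  have h1 : (α : A ⊗[k] g) ∈ tensorIdeal g (∏ γ : Γ, c γ I) := by
    refine mem_tensorIdeal_prod hcop fun γ _ => ?_
    rw [← α.2 γ⁻¹]
    exact diag_mem_tensorIdeal (fun a ha => by rwa [hmem, smul_inv_smul]) hα
  refine tensorIdeal_mono ?_ h1
  -- Pull-back along an automorphism is push-forward along its inverse, and push-forward respects
  -- powers.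
  have h2 : ∀ γ, c γ I ≤ c γ Q ^ n := by
    intro γ a ha
    rw [hmem, hIQ] at ha
    have h3 := Ideal.mem_map_of_mem (MulSemiringAction.toRingHom Γ A γ⁻¹) ha
    rw [Ideal.map_pow] at h3
    have h4 : γ⁻¹ • γ • a ∈ _ := h3
    rw [inv_smul_smul] at h4
    refine Ideal.pow_right_mono ?_ n h4
    rw [Ideal.map_le_iff_le_comap]
    intro b hb
    change γ⁻¹ • b ∈ c γ Q
    rwa [hmem, smul_inv_smul]
  refine (Finset.prod_le_prod' fun γ _ => h2 γ).trans ?_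
  rw [Finset.prod_pow]
  refine Ideal.pow_right_mono (fun a ha => ?_) n
  rw [mem_orbitIdeal]
  rintro _ ⟨γ, y, hy, rfl⟩
  -- The factor indexed by `γ⁻¹` is the one whose elements vanish at `γ • y`.
  have h3 : a ∈ c γ⁻¹ Q := (Ideal.prod_le_inf.trans (Finset.inf_le (Finset.mem_univ γ⁻¹))) ha
  rw [RatPt.smul_eval]
  exact prod_maxIdeal_le hy ((hmem _ _ _).mp h3)

/-- Modules in `𝓕^Γ_x` are annihilated by `(g ⊗ I_η)^Γ` for some `η` supported in `x`. -/
theorem FXΓ.exists_annihilates [IsAlgClosed k] [CharZero k] [Algebra.FiniteType k A]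
    [LieAlgebra.IsSemisimple k g] [Fintype Γ] (hfree : ActsFreely Γ k A)
    {x : Finset (RatPt k A)} (hx : x ∈ XStar Γ k A) {V : FDMod.{u, _, w} k (EMA k A g Γ)}
    (hV : FXΓ g Γ x V) :
    ∃ η : RatPt k A →₀ ℕ, η.support ⊆ x ∧ Annihilates (powIdeal η) V := by
  suffices h : ∃ n, ∀ α ∈ fixedIdeal g Γ (orbitIdeal Γ x ^ (n + 1)), V.ρ α = 0 by
    obtain ⟨n, hn⟩ := h
    refine ⟨constExp x (n + 1), constExp_support x _, fun α hα m => ?_⟩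
    exact LinearMap.congr_fun (hn α (mem_tensorIdeal_orbitIdeal_pow hfree hx _ hα)) m
  refine exists_forall_rho_eq_zero V (fun n => fixedIdeal g Γ (orbitIdeal Γ x ^ n))
    (fun n => ?_) (fun S hS α hα m => ?_)
  · have h := fun n => smul_mem_pow (I := orbitIdeal Γ x) (fun γ a => smul_mem_orbitIdeal γ) n
    rw [pow_succ' _ (n + 1)]
    nth_rewrite 1 [← pow_one (orbitIdeal Γ x)]
    exact fixedIdeal_mul_le hfree (h 1) (h (n + 1))
  · obtain ⟨ψ, -, ⟨s, hs, hev⟩, hψ⟩ := hV S hS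
    rw [pow_one] at hα
    refine hev.lie_eq_zero (fun y hy => evalAt_eq_zero (I := orbitIdeal Γ x) (fun a ha => ?_) hα) m
    exact mem_orbitIdeal.mp ha y (hψ (hs.1 hy))

end Annihilation

/-! ### Constituents under a change of Lie algebra -/

section Constituents

attribute [local instance 100] LieRing.ofAssociativeRing

variable {k : Type u} {L : Type v} [Field k] [LieRing L] [LieAlgebra k L]

/-- A constituent of `V` is an irreducible quotient of a submodule of `V`. -/
lemma isConstituent_iff {S V : FDMod.{u, v, w} k L} :
    IsConstituent S V ↔ LieModule.IsIrreducible k L S ∧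
      ∃ (N : LieSubmodule k L V) (p : N →ₗ⁅k, L⁆ S), Function.Surjective p := by
  refine and_congr_right fun _ => ⟨?_, ?_⟩
  · rintro ⟨N', N, -, ⟨e⟩⟩
    exact ⟨N, e.symm.toLieModuleHom.comp (LieSubmodule.Quotient.mk' _),
      e.symm.surjective.comp (LieSubmodule.Quotient.surjective_mk' _)⟩
  · rintro ⟨N, p, hp⟩
    have hker : (p.ker.map N.incl).comap N.incl = p.ker :=
      LieSubmodule.comap_map_eq _ _ N.ker_incl
    refine ⟨p.ker.map N.incl, N, LieSubmodule.map_incl_le, ?_⟩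
    rw [hker]
    let q : (N ⧸ p.ker) →ₗ⁅k, L⁆ S :=
      { toLinearMap := p.ker.toSubmodule.liftQ p.toLinearMap fun n hn => hn
        map_lie' := fun {a n} => by
          obtain ⟨n, rfl⟩ := LieSubmodule.Quotient.surjective_mk' _ n
          exact p.map_lie a n }
    refine ⟨(lieModuleEquivOfBijective q ⟨?_, fun s => ?_⟩).symm⟩
    · rw [injective_iff_map_eq_zero]
      intro n hn
      obtain ⟨n, rfl⟩ := LieSubmodule.Quotient.surjective_mk' _ n
      exact LieSubmodule.Quotient.mk_eq_zero'.mpr hn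
    · obtain ⟨n, rfl⟩ := hp s
      exact ⟨LieSubmodule.Quotient.mk n, rfl⟩

/-- Annihilators pass to subquotients, so constituents of a module that can be untwisted can be
untwisted too. -/
lemma IsConstituent.rho_eq_zero {S V : FDMod.{u, v, w} k L} (h : IsConstituent S V) {a : L}
    (ha : V.ρ a = 0) : S.ρ a = 0 := by
  obtain ⟨-, N, p, hp⟩ := isConstituent_iff.mp h
  refine LinearMap.ext fun s => ?_
  obtain ⟨n, rfl⟩ := hp s
  have h1 : ⁅a, n⁆ = 0 := Subtype.ext (LinearMap.congr_fun ha n)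
  have h2 := p.map_lie a n
  rw [h1, map_zero] at h2
  exact h2.symm

variable {L' : Type*} [LieRing L'] [LieAlgebra k L']

/-- A submodule over `L` is a submodule over `L'`. -/
def pullbackSubmodule (f : L' →ₗ⁅k⁆ L) {V : FDMod.{u, v, w} k L} (N : LieSubmodule k L V) :
    LieSubmodule k L' (V.pullback f) :=
  { N.toSubmodule with lie_mem := fun {a _} hm => N.lie_mem (x := f a) hm }

/-- If every element of `L` acts on `V` as an element of `L'`, then the `L'`-submodules are
`L`-submodules. -/
def liftSubmodule {f : L' →ₗ⁅k⁆ L} {V : FDMod.{u, v, w} k L}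
    (h : ∀ b : L, ∃ a : L', V.ρ b = V.ρ (f a)) (N : LieSubmodule k L' (V.pullback f)) :
    LieSubmodule k L V :=
  { N.toSubmodule with
    lie_mem := fun {b m} hm => by
      obtain ⟨a, ha⟩ := h b
      have h1 : V.ρ (f a) m ∈ N := N.lie_mem (x := a) hm
      rw [← ha] at h1
      exact h1 }

/-- The two algebras act through the same operators, hence have the same invariant subspaces. -/
lemma isIrreducible_pullback_iff {f : L' →ₗ⁅k⁆ L} {V : FDMod.{u, v, w} k L}
    (h : ∀ b : L, ∃ a : L', V.ρ b = V.ρ (f a)) :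
    LieModule.IsIrreducible k L' (V.pullback f) ↔ LieModule.IsIrreducible k L V := by
  constructor
  · intro hirr
    have : Nontrivial V.carrier := LieModule.nontrivial_of_isIrreducible k L' (V.pullback f)
    refine LieModule.IsIrreducible.mk fun N hN => ?_
    have h1 := eq_bot_or_eq_top (pullbackSubmodule f N)
    rw [← LieSubmodule.toSubmodule_eq_bot, ← LieSubmodule.toSubmodule_eq_top] at h1
    rw [← LieSubmodule.toSubmodule_eq_top]
    rw [ne_eq, ← LieSubmodule.toSubmodule_eq_bot] at hN
    exact h1.resolve_left hN
  · intro hirr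
    have : Nontrivial (V.pullback f).carrier := LieModule.nontrivial_of_isIrreducible k L V
    refine LieModule.IsIrreducible.mk fun N hN => ?_
    have h1 := eq_bot_or_eq_top (liftSubmodule h N)
    rw [← LieSubmodule.toSubmodule_eq_bot, ← LieSubmodule.toSubmodule_eq_top] at h1
    rw [← LieSubmodule.toSubmodule_eq_top]
    rw [ne_eq, ← LieSubmodule.toSubmodule_eq_bot] at hN
    exact h1.resolve_left hN

/-- If `L` and `L'` act through the same operators on `S` and `V`, then constituents over `L` and
over `L'` are the same. -/
lemma isConstituent_pullback_iff {f : L' →ₗ⁅k⁆ L} {S V : FDMod.{u, v, w} k L}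
    (h : ∀ b : L, ∃ a : L', S.ρ b = S.ρ (f a) ∧ V.ρ b = V.ρ (f a)) :
    IsConstituent (S.pullback f) (V.pullback f) ↔ IsConstituent S V := by
  rw [isConstituent_iff, isConstituent_iff,
    isIrreducible_pullback_iff fun b => (h b).imp fun _ h => h.1]
  refine and_congr_right fun _ => ⟨?_, ?_⟩
  · rintro ⟨N, p, hp⟩
    have hV : ∀ b : L, ∃ a : L', V.ρ b = V.ρ (f a) := fun b => (h b).imp fun _ h => h.2
    refine ⟨liftSubmodule hV N,
      { toLinearMap := p.toLinearMap
        map_lie' := fun {b n} => ?_ }, hp⟩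
    obtain ⟨a, ha, ha'⟩ := h b
    have h1 : ⁅b, n⁆ = (⁅a, (show N from n)⁆ : N) :=
      Subtype.ext (LinearMap.congr_fun ha' (n : V.carrier))
    exact (congrArg p h1).trans ((p.map_lie a n).trans (LinearMap.congr_fun ha (p n)).symm)
  · rintro ⟨N, p, hp⟩
    exact ⟨pullbackSubmodule f N,
      { toLinearMap := p.toLinearMap
        map_lie' := fun {a n} => p.map_lie (f a) n }, hp⟩

/-- The only constituent of an irreducible module is the module itself. -/
lemma IsConstituent.nonempty_equiv {S V : FDMod.{u, v, w} k L} (h : IsConstituent S V)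
    (hV : LieModule.IsIrreducible k L V) : Nonempty (S ≃ₗ⁅k, L⁆ V) := by
  obtain ⟨hS, N, p, hp⟩ := isConstituent_iff.mp h
  have := LieModule.nontrivial_of_isIrreducible k L S
  have hinj : Function.Injective p := by
    rw [← LieModuleHom.ker_eq_bot]
    rcases eq_bot_or_eq_top (p.ker.map N.incl) with h0 | h1
    · rw [eq_bot_iff]
      intro n hn
      have h2 : (n : V) ∈ p.ker.map N.incl := (LieSubmodule.mem_map _).mpr ⟨n, hn, rfl⟩
      rw [h0, LieSubmodule.mem_bot] at h2
      exact (LieSubmodule.mem_bot _).mpr (Subtype.ext h2)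
    · obtain ⟨s, hs⟩ := exists_ne (0 : S.carrier)
      obtain ⟨n, rfl⟩ := hp s
      have h2 : (n : V) ∈ p.ker.map N.incl := h1 ▸ trivial
      obtain ⟨n', hn', he⟩ := (LieSubmodule.mem_map _).mp h2
      rw [← (Subtype.ext he : n' = n)] at hs
      exact (hs hn').elim
  let e := lieModuleEquivOfBijective p ⟨hinj, hp⟩
  let F : S →ₗ⁅k, L⁆ V := N.incl.comp e.symm.toLieModuleHom
  have hF : Function.Injective F := (LieSubmodule.injective_incl N).comp e.symm.injective
  exact ⟨lieModuleEquivOfBijective F (bijective_of_injective_of_irreducible F hF)⟩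

end Constituents

/-! ### Irreducibility of evaluation representations -/

section EvalRep

attribute [local instance 100] LieRing.ofAssociativeRing

variable {k : Type u} {A : Type*} {g : Type*} {Γ : Type*} [Field k] [CommRing A] [Algebra k A]
  [LieRing g] [LieAlgebra k g] [Group Γ] [MulSemiringAction Γ A] [SMulCommClass Γ k A]
  [LieMulAction Γ g] [SMulCommClass Γ k g]

lemma IsEvalRep.of_equiv {L : Type*} [LieRing L] [LieAlgebra k L]
    {ev : RatPt k A → (L →ₗ⁅k⁆ g)} {s : Finset (RatPt k A)} {ψ : RatPt k A → PPlus k g}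
    {V W : FDMod.{u, _, w} k L} (hV : IsEvalRep ev s ψ V) (e : W ≃ₗ⁅k, L⁆ V) :
    IsEvalRep ev s ψ W := by
  obtain ⟨R, hR, φ, hφ⟩ := hV
  refine ⟨R, hR, e.toLinearEquiv.trans φ, fun α m => ?_⟩
  have h1 : e ⁅α, m⁆ = ⁅α, e m⁆ := e.toLieModuleHom.map_lie α m
  change φ (e ⁅α, m⁆) = _
  rw [h1]
  exact hφ α (e m)

/-- Points of a finite set are separated by a function. -/
lemma exists_eval_eq_one (s : Finset (RatPt k A)) (y : RatPt k A) :
    ∃ f : A, y.eval f = 1 ∧ ∀ z ∈ s, z ≠ y → z.eval f = 0 := by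
  classical
  have h : ∀ z : RatPt k A, z ≠ y → ∃ f : A, y.eval f = 1 ∧ z.eval f = 0 := by
    intro z hz
    obtain ⟨a, ha⟩ : ∃ a, y.eval a ≠ z.eval a := by
      by_contra hcon
      push Not at hcon
      exact hz (RatPt.ext fun a => (hcon a).symm)
    refine ⟨(y.eval a - z.eval a)⁻¹ • (a - algebraMap k A (z.eval a)), ?_, ?_⟩
    · simp [sub_ne_zero.mpr ha]
    · simp
  choose! f h1 h0 using h
  refine ⟨∏ z ∈ s.erase y, f z, ?_, fun z hz hne => ?_⟩
  · rw [map_prod]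
    exact Finset.prod_eq_one fun z hz => h1 z (Finset.ne_of_mem_erase hz)
  · rw [map_prod]
    exact Finset.prod_eq_zero (Finset.mem_erase.mpr ⟨hne, hz⟩) (h0 z hne)

lemma transversals_subset_XStar {Y : Set (RatPt k A)} {s : Finset (RatPt k A)}
    (hs : s ∈ transversals Γ Y) : s ∈ XStar Γ k A := by
  rintro y hy z hz ⟨γ, hγ⟩
  exact (hs.2 y (hs.1 hy)).unique ⟨hy, 1, (one_smul Γ y).symm⟩ ⟨hz, γ, hγ.symm⟩

/-- `(g ⊗ A)^Γ` separates the points of a member of `X_*`. -/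
lemma exists_evalAtΓ_eq [Finite Γ] (hfree : ActsFreely Γ k A) {s : Finset (RatPt k A)}
    (hs : s ∈ XStar Γ k A) {y : RatPt k A} (hy : y ∈ s) (u : g) :
    ∃ α : EMA k A g Γ, evalAtΓ Γ y α = u ∧ ∀ z ∈ s, z ≠ y → evalAtΓ Γ z α = 0 := by
  obtain ⟨f, hf1, hf0⟩ := exists_eval_eq_one s y
  -- Exponent `1` at every point of `s` suffices: the congruence then preserves the values there.
  obtain ⟨α, hα⟩ := fixedSurj (g := g) hfree hs (constExp_support s 1) (f ⊗ₜ u)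
  have key : ∀ z ∈ s, evalAtΓ Γ z α = z.eval f • u := by
    intro z hz
    rw [← evalAt_tmul, ← sub_eq_zero]
    change evalAt z (α : A ⊗[k] g) - _ = 0
    rw [← map_sub]
    refine evalAt_eq_zero ?_ hα
    rw [powIdeal_constExp, pow_one]
    exact prod_maxIdeal_le hz
  exact ⟨α, by rw [key y hy, hf1, one_smul],
    fun z hz hne => by rw [key z hz, hf0 z hz hne, zero_smul]⟩

lemma IrrRep.eq_bot_or_eq_top (V : IrrRep k g) (W : Submodule k V.1)
    (hW : ∀ a, ∀ m ∈ W, V.1.ρ a m ∈ W) : W = ⊥ ∨ W = ⊤ := by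
  have := V.2
  let W' : LieSubmodule k g V.1 := { W with lie_mem := fun {a m} hm => hW a m hm }
  have h := IsSimpleOrder.eq_bot_or_eq_top W'
  rwa [← LieSubmodule.toSubmodule_eq_bot, ← LieSubmodule.toSubmodule_eq_top] at h

/-- Evaluation representations at points of distinct orbits are irreducible. -/
theorem IsEvalRep.isIrreducible [IsAlgClosed k] [Finite Γ] (hfree : ActsFreely Γ k A)
    {s : Finset (RatPt k A)} (hs : s ∈ XStar Γ k A) {ψ : RatPt k A → PPlus k g}
    {V : FDMod.{u, _, w} k (EMA k A g Γ)} (hV : IsEvalRep (evalAtΓ Γ) s ψ V) :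
    LieModule.IsIrreducible k (EMA k A g Γ) V := by
  classical
  obtain ⟨R, -, φ, hφ⟩ := hV
  have : Nontrivial V.carrier := by
    choose v hv using fun y : s => exists_ne (0 : (R y).1.carrier)
    exact ⟨φ.symm (PiTensorProduct.tprod k v), 0, fun h =>
      tprod_ne_zero (k := k) hv ((map_eq_zero_iff φ.symm φ.symm.injective).mp h)⟩
  refine LieModule.IsIrreducible.mk fun N hN => ?_
  have h := piTensor_eq_bot_or_eq_top (fun (y : s) (a : g) => (R y).1.ρ a)
    (fun y W hW => (R y).eq_bot_or_eq_top W hW)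
    (N.toSubmodule.map (φ : V.carrier →ₗ[k] ⨂[k] y : s, (R y).1.carrier)) (fun y a m hm => ?_)
  · rw [ne_eq, ← LieSubmodule.toSubmodule_eq_bot] at hN
    rw [← LieSubmodule.toSubmodule_eq_top]
    rcases h with h | h
    · exact (hN ((Submodule.map_eq_bot_iff (e := φ)).mp h)).elim
    · rw [eq_top_iff]
      intro m _
      have h1 : φ m ∈ N.toSubmodule.map (φ : V.carrier →ₗ[k] ⨂[k] y : s, (R y).1.carrier) :=
        h ▸ trivial
      obtain ⟨m', hm', he⟩ := h1
      rwa [← φ.injective he]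
  · obtain ⟨m, hm, rfl⟩ := hm
    -- A fixed `α` with value `a` at `y` and `0` at the other points acts on the slot `y` alone.
    obtain ⟨α, hα, hα0⟩ := exists_evalAtΓ_eq (g := g) hfree hs y.2 a
    refine ⟨⁅α, m⁆, N.lie_mem hm, (hφ α m).trans ?_⟩
    have h1 : tensorRep (M := fun z : s => (R z).1.carrier)
        (fun z : s => ((R z).1.pullback (evalAtΓ Γ z)).ρ) α = _ := tensorRep_eq_single y ?_
    rotate_left
    · intro z hz
      change (R z).1.ρ (evalAtΓ Γ z α) = 0
      rw [hα0 z z.2 fun h => hz (Subtype.ext h), map_zero]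
    rw [← hα]
    exact LinearMap.congr_fun h1 (φ m)

end EvalRep

/-! ### The function `ψ^Γ` and restriction of evaluation modules -/

section TwistFun

variable {k : Type u} {A : Type*} {g : Type*} {Γ : Type*} [Field k] [CommRing A] [Algebra k A]
  [LieRing g] [LieAlgebra k g] [Group Γ] [MulSemiringAction Γ A] [SMulCommClass Γ k A]
  [LieMulAction Γ g] [SMulCommClass Γ k g]

lemma PPlus.smul_ne_zero (γ : Γ) {p : PPlus k g} (hp : p ≠ 0) : γ • p ≠ 0 := by
  intro h
  apply hp
  rw [← PPlus.one_smul (Γ := Γ) p, ← inv_mul_cancel γ, PPlus.mul_smul, h, PPlus.smul_zero]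

variable [IsAlgClosed k] [CharZero k] [FiniteDimensional k g] [Fintype Γ]
  {ψ : RatPt k A → PPlus k g}

/-- A nonzero summand `δ` needs `δ⁻¹ • γ • y ∈ s`. This point is in the orbit of `y`, so it is `y`,
and freeness gives `δ = γ`. -/
lemma twistFun_apply (hfree : ActsFreely Γ k A) {s : Finset (RatPt k A)} (hs : s ∈ XStar Γ k A)
    (hψ : supp ψ = s) (γ : Γ) {y : RatPt k A} (hy : y ∈ s) :
    twistFun (Γ := Γ) ψ (γ • y) = γ • ψ y := by
  rw [twistFun, weightSum_eq_of_forall_ne γ, inv_smul_smul]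
  intro δ hδ
  by_cases h0 : ψ (δ⁻¹ • γ • y) = 0
  · rw [h0, PPlus.smul_zero]
  have h1 : δ⁻¹ • γ • y ∈ s := by
    have : δ⁻¹ • γ • y ∈ supp ψ := h0
    rwa [hψ] at this
  have h2 := hs y hy _ h1 ⟨δ⁻¹ * γ, mul_smul _ _ _⟩
  rw [← mul_smul] at h2
  exact (hδ (inv_mul_eq_one.mp (hfree _ _ h2.symm))).elim

lemma twistFun_apply_eq_zero (ψ : RatPt k A → PPlus k g) {y : RatPt k A}
    (hy : ∀ γ : Γ, γ • y ∉ supp ψ) : twistFun (Γ := Γ) ψ y = 0 := by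
  have h : ∀ γ : Γ, γ • ψ (γ⁻¹ • y) = 0 := fun γ => by
    rw [not_not.mp (hy γ⁻¹), PPlus.smul_zero]
  rw [twistFun, weightSum_eq_of_forall_ne (1 : Γ) fun γ _ => h γ, h 1]

lemma supp_twistFun (hfree : ActsFreely Γ k A) {s : Finset (RatPt k A)} (hs : s ∈ XStar Γ k A)
    (hψ : supp ψ = s) : supp (twistFun (Γ := Γ) ψ) = orbits Γ (s : Set (RatPt k A)) := by
  ext z
  constructor
  · intro hz
    by_contra hcon
    refine hz (twistFun_apply_eq_zero ψ fun γ hγ => hcon ⟨γ⁻¹, γ • z, hψ ▸ hγ, ?_⟩)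
    rw [inv_smul_smul]
  · rintro ⟨γ, y, hy, rfl⟩
    have h1 : ψ y ≠ 0 := (hψ ▸ hy : y ∈ supp ψ)
    rw [supp, Set.mem_ofPred_eq, twistFun_apply hfree hs hψ γ hy]
    exact PPlus.smul_ne_zero γ h1

/-- `ψ^Γ` lies in `𝓔^Γ`. -/
lemma twistFun_mem (hfree : ActsFreely Γ k A) {s : Finset (RatPt k A)} (hs : s ∈ XStar Γ k A)
    (hψ : supp ψ = s) : twistFun (Γ := Γ) ψ ∈ EEΓ k A g Γ := by
  refine ⟨?_, fun γ y => ?_⟩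
  · rw [EE, Set.mem_ofPred_eq, supp_twistFun hfree hs hψ]
    refine ((Set.finite_univ (α := Γ)).prod s.finite_toSet).image (fun p => p.1 • p.2) |>.subset ?_
    rintro _ ⟨γ, y, hy, rfl⟩
    exact ⟨(γ, y), ⟨trivial, hy⟩, rfl⟩
  · by_cases h : ∃ δ : Γ, ∃ z ∈ s, y = δ • z
    · obtain ⟨δ, z, hz, rfl⟩ := h
      rw [← mul_smul, twistFun_apply hfree hs hψ _ hz, twistFun_apply hfree hs hψ _ hz,
        PPlus.mul_smul]
    · have h' : ∀ δ : Γ, δ • y ∉ supp ψ := fun δ hδ =>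
        h ⟨δ⁻¹, δ • y, by rwa [hψ] at hδ, (inv_smul_smul δ y).symm⟩
      rw [twistFun_apply_eq_zero ψ h', PPlus.smul_zero, twistFun_apply_eq_zero]
      intro δ
      rw [← mul_smul]
      exact h' _

/-- `T` maps `ev_ψ` to `ev^Γ_{ψ^Γ}`. -/
theorem IsEv.twist (hfree : ActsFreely Γ k A) {s : Finset (RatPt k A)} (hs : s ∈ XStar Γ k A)
    (hψ : supp ψ = s) {V : FDMod.{u, _, w} k (A ⊗[k] g)} (hV : IsEv ψ V) :
    IsEvΓ (twistFun (Γ := Γ) ψ) ((twistFunctor k A g Γ).obj V) := by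
  obtain ⟨s', hs', R, hR, φ, hφ⟩ := hV
  obtain rfl : s' = s := Finset.coe_injective (hs'.trans hψ)
  -- The factors and the isomorphism are kept: `s'` is already a set of orbit representatives for
  -- the larger support, and `ψ^Γ` agrees with `ψ` on it.
  refine ⟨s', ⟨?_, ?_⟩, R, fun y => ?_, φ, fun α m => hφ α m⟩
  · rw [supp_twistFun hfree hs hψ]
    exact fun y hy => ⟨1, y, hy, (one_smul Γ y).symm⟩
  · rw [supp_twistFun hfree hs hψ]
    rintro _ ⟨γ, y, hy, rfl⟩
    refine ⟨y, ⟨hy, γ⁻¹, (inv_smul_smul γ y).symm⟩, ?_⟩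
    rintro z ⟨hz, δ, rfl⟩
    exact (hs y hy _ hz ⟨δ * γ, mul_smul _ _ _⟩).symm
  · have h1 := twistFun_apply hfree hs hψ 1 y.2
    rw [one_smul, PPlus.one_smul] at h1
    rw [hR, h1]

end TwistFun

/-! ### Reindexing tensor products of representations -/

section Reindex

attribute [local instance 100] LieRing.ofAssociativeRing

variable {k : Type*} {L : Type*} [Field k] [LieRing L] [LieAlgebra k L]
variable {ι ι' : Type*} [Fintype ι] [Fintype ι'] {M : ι → Type*} [∀ i, AddCommGroup (M i)]
  [∀ i, Module k (M i)]

lemma reindex_tensorRep (e : ι ≃ ι') (ρ : ∀ i, L →ₗ⁅k⁆ Module.End k (M i)) (x : L)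
    (m : ⨂[k] i, M i) :
    PiTensorProduct.reindex k M e (tensorRep ρ x m) =
      tensorRep (fun j => ρ (e.symm j)) x (PiTensorProduct.reindex k M e m) := by
  classical
  induction m using PiTensorProduct.induction_on with
  | smul_tprod c v =>
    simp only [map_smul, PiTensorProduct.reindex_tprod, tensorRep_tprod, map_sum]
    congr 1
    refine Fintype.sum_equiv e _ _ fun i => ?_
    congr 1
    funext j
    by_cases hj : e.symm j = i
    · subst hj
      rw [Function.update_self, e.apply_symm_apply, Function.update_self]
    · rw [Function.update_of_ne hj,
        Function.update_of_ne fun h => hj (by rw [h, e.symm_apply_apply])]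
  | add m m' h h' => simp only [map_add, h, h']

end Reindex

/-! ### Untwisting evaluation modules -/

section Untwisting

attribute [local instance 100] LieRing.ofAssociativeRing

variable {k : Type u} {A : Type*} {g : Type*} {Γ : Type*} [Field k] [CommRing A] [Algebra k A]
  [LieRing g] [LieAlgebra k g] [Group Γ] [MulSemiringAction Γ A] [SMulCommClass Γ k A]
  [LieMulAction Γ g] [SMulCommClass Γ k g]

lemma evalAt_smul_diag (γ : Γ) (y : RatPt k A) (α : A ⊗[k] g) :
    evalAt (γ • y) (diag k A g γ α) = γ • evalAt y α := by
  induction α with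
  | zero => simp
  | add α β h1 h2 => simp only [map_add, h1, h2, smul_add]
  | tmul a u =>
    rw [diag_tmul, evalAt_tmul, evalAt_tmul, RatPt.smul_eval, inv_smul_smul]
    exact (smul_comm γ (y.eval a) u).symm

/-- Fixed elements are equivariant maps, so another orbit representative only twists the factor by
an automorphism of `g`. -/
lemma evalAtΓ_smul (γ : Γ) (y : RatPt k A) (α : EMA k A g Γ) :
    evalAtΓ Γ (γ • y) α = γ • evalAtΓ Γ y α := by
  have h := evalAt_smul_diag γ y (α : A ⊗[k] g)
  rwa [α.2 γ] at h

/-- Elements of `g ⊗ A` are congruent to elements of `(g ⊗ A)^Γ` modulo both `g ⊗ I_η` and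
`g ⊗ I_η'`. -/
lemma exists_sub_mem_tensorIdeal [Finite Γ] (hfree : ActsFreely Γ k A) {x : Finset (RatPt k A)}
    (hx : x ∈ XStar Γ k A) {η η' : RatPt k A →₀ ℕ} (hη : η.support ⊆ x) (hη' : η'.support ⊆ x)
    (β : A ⊗[k] g) : ∃ α : EMA k A g Γ, (α : A ⊗[k] g) - β ∈ tensorIdeal g (powIdeal η) ∧
      (α : A ⊗[k] g) - β ∈ tensorIdeal g (powIdeal η') := by
  classical
  have hsupp : (η + η').support ⊆ x := Finsupp.support_add.trans (Finset.union_subset hη hη')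
  obtain ⟨α, hα⟩ := fixedSurj (g := g) hfree hx hsupp β
  rw [powIdeal_add] at hα
  have h1 : powIdeal η * powIdeal η' ≤ powIdeal η := Ideal.mul_le_left
  have h2 : powIdeal η * powIdeal η' ≤ powIdeal η' := Ideal.mul_le_right
  exact ⟨α, tensorIdeal_mono h1 hα, tensorIdeal_mono h2 hα⟩

lemma rho_eq_of_sub_mem {I : Ideal A} {S : FDMod.{u, _, w} k (A ⊗[k] g)}
    (hS : ∀ α ∈ tensorIdeal g I, S.ρ α = 0) {α β : A ⊗[k] g} (h : α - β ∈ tensorIdeal g I) :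
    S.ρ β = S.ρ α := by
  have h1 := hS _ h
  rw [map_sub, sub_eq_zero] at h1
  exact h1.symm

/-- The support of `ψ_x` is `x ∩ supp ψ`. -/
lemma supp_restrictFun (x : Finset (RatPt k A)) (ψ : RatPt k A → PPlus k g) :
    supp (restrictFun x ψ) = {y | y ∈ x ∧ ψ y ≠ 0} := by
  ext y
  by_cases hy : y ∈ x <;> simp [supp, restrictFun, hy]

lemma restrictFun_mem_EE (x : Finset (RatPt k A)) (ψ : RatPt k A → PPlus k g) :
    restrictFun x ψ ∈ EE k A g := by
  rw [EE, Set.mem_ofPred_eq, supp_restrictFun]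
  exact x.finite_toSet.subset fun y hy => hy.1

/-- A `(g ⊗ A)`-module annihilated by `g ⊗ I_η` whose restriction to `(g ⊗ A)^Γ` is in `ev^Γ_ψ` is
in `ev_{ψ_x}`. -/
theorem IsEvΓ.isEv_restrictFun [Finite Γ] (hfree : ActsFreely Γ k A) {x : Finset (RatPt k A)}
    (hx : x ∈ XStar Γ k A) {η : RatPt k A →₀ ℕ} (hη : η.support ⊆ x)
    {S : FDMod.{u, _, w} k (A ⊗[k] g)} (hS : ∀ α ∈ tensorIdeal g (powIdeal η), S.ρ α = 0)
    {ψ : RatPt k A → PPlus k g} (hψ : ψ ∈ EEΓ k A g Γ)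
    (hsupp : supp ψ ⊆ orbits Γ (x : Set (RatPt k A)))
    (hev : IsEvΓ ψ ((twistFunctor k A g Γ).obj S)) : IsEv (restrictFun x ψ) S := by
  classical
  obtain ⟨s, hs, R, hR, φ, hφ⟩ := hev
  let s' : Finset (RatPt k A) := x.filter fun y => ψ y ≠ 0
  have hs' : ∀ {y}, y ∈ s' ↔ y ∈ x ∧ ψ y ≠ 0 := Finset.mem_filter
  have hrep : ∀ z : s, ∃ γ : Γ, ∃ y : s', (z : RatPt k A) = γ • (y : RatPt k A) := by
    intro z
    obtain ⟨γ, y, hy, hz⟩ := hsupp (hs.1 z.2)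
    refine ⟨γ, ⟨y, hs'.mpr ⟨hy, fun h0 => ?_⟩⟩, hz⟩
    have h1 : ψ z ≠ 0 := hs.1 z.2
    rw [hz, hψ.2, h0, PPlus.smul_zero] at h1
    exact h1 rfl
  choose c F hF using hrep
  -- Both `s` and `s'` contain exactly one point of each orbit in `supp ψ`.
  have hbij : Function.Bijective F := by
    constructor
    · intro z z' hzz'
      refine Subtype.ext ((hs.2 (F z) (hs'.mp (F z).2).2).unique ⟨z.2, c z, hF z⟩
        ⟨z'.2, c z', ?_⟩)
      rw [hzz']
      exact hF z'
    · intro y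
      obtain ⟨z, ⟨hz, γ, hzγ⟩, -⟩ := hs.2 y (hs'.mp y.2).2
      refine ⟨⟨z, hz⟩, Subtype.ext ?_⟩
      refine hx _ (hs'.mp (F ⟨z, hz⟩).2).1 _ (hs'.mp y.2).1 ⟨γ⁻¹ * c ⟨z, hz⟩, ?_⟩
      rw [mul_smul, ← hF ⟨z, hz⟩, inv_smul_eq_iff]
      exact hzγ
  let e : s ≃ s' := Equiv.ofBijective F hbij
  have he : ∀ y : s', (e.symm y : RatPt k A) = c (e.symm y) • (y : RatPt k A) := fun y => by
    have h1 := hF (e.symm y)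
    rwa [show F (e.symm y) = y from e.apply_symm_apply y] at h1
  -- Equivariance gives `ψ(c • y) = c • ψ(y)`, so undoing `c` produces the class `ψ(y)`.
  let R' : s' → IrrRep k g := fun y => (R (e.symm y)).twist (c (e.symm y))⁻¹
  refine ⟨s', ?_, R', fun y => ?_,
    φ.trans (PiTensorProduct.reindex k (fun z : s => (R z).1.carrier) e), fun β m => ?_⟩
  · rw [supp_restrictFun]
    ext y
    exact hs'
  · have h1 : ψ y = restrictFun x ψ y := (if_pos (hs'.mp y.2).1).symm
    change (c (e.symm y))⁻¹ • (R (e.symm y)).cls = _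
    rw [hR, ← hψ.2, he, inv_smul_smul, h1]
  · obtain ⟨α, hα, hα'⟩ := exists_sub_mem_tensorIdeal hfree hx hη (constExp_support x 1) β
    rw [powIdeal_constExp, pow_one] at hα'
    have h1 : ⁅β, m⁆ = S.ρ α m := LinearMap.congr_fun (rho_eq_of_sub_mem hS hα) m
    rw [h1]
    change PiTensorProduct.reindex k (fun z : s => (R z).1.carrier) e (φ (S.ρ α m)) = _
    have hre : PiTensorProduct.reindex k (fun z : s => (R z).1.carrier) e
        (tensorRep (M := fun z : s => (R z).1.carrier)
          (fun z : s => ((R z).1.pullback (evalAtΓ Γ z)).ρ) α (φ m)) =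
        tensorRep (M := fun y : s' => (R (e.symm y)).1.carrier)
          (fun y : s' => ((R (e.symm y)).1.pullback (evalAtΓ Γ (e.symm y))).ρ) α
          (PiTensorProduct.reindex k (fun z : s => (R z).1.carrier) e (φ m)) :=
      reindex_tensorRep e _ α (φ m)
    refine ((congrArg _ (hφ α m)).trans hre).trans ?_
    have hact : tensorRep (M := fun y : s' => (R' y).1.carrier)
        (fun y : s' => ((R (e.symm y)).1.pullback (evalAtΓ Γ (e.symm y))).ρ) α =
        tensorRep (fun y : s' => ((R' y).1.pullback (evalAt (y : RatPt k A))).ρ) β :=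
      tensorRep_congr fun y => ?_
    · exact LinearMap.congr_fun hact _
    change (R (e.symm y)).1.ρ (evalAtΓ Γ (e.symm y) α) =
      (R (e.symm y)).1.ρ ((c (e.symm y))⁻¹⁻¹ • evalAt (y : RatPt k A) β)
    have h2 : evalAt (y : RatPt k A) (α : A ⊗[k] g) = evalAt (y : RatPt k A) β := by
      rw [← sub_eq_zero, ← map_sub]
      exact evalAt_eq_zero (prod_maxIdeal_le (hs'.mp y.2).1) hα'
    rw [he, evalAtΓ_smul, inv_inv, ← h2]
    rfl

end Untwisting

/-! ### Underlying linear maps of morphisms -/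

section Hom

attribute [local instance 100] LieRing.ofAssociativeRing

variable {k : Type u} {L : Type v} [Field k] [LieRing L] [LieAlgebra k L]

/-- The linear map underlying a morphism. -/
def homLin {V W : FDMod.{u, v, w} k L} (f : V ⟶ W) : V.carrier →ₗ[k] W.carrier :=
  LieModuleHom.toLinearMap (L := L) (M := V.carrier) (N := W.carrier) f

lemma homLin_injective {V W : FDMod.{u, v, w} k L} {f f' : V ⟶ W} (h : homLin f = homLin f') :
    f = f' :=
  LieModuleHom.ext (L := L) (M := V.carrier) (N := W.carrier) fun m => LinearMap.congr_fun h m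

lemma homLin_map_rho {V W : FDMod.{u, v, w} k L} (f : V ⟶ W) (a : L) (m : V.carrier) :
    homLin f (V.ρ a m) = W.ρ a (homLin f m) :=
  LieModuleHom.map_lie (L := L) (M := V.carrier) (N := W.carrier) f a m

lemma homLin_comp {V W X : FDMod.{u, v, w} k L} (f : V ⟶ W) (f' : W ⟶ X) :
    homLin (f ≫ f') = homLin f' ∘ₗ homLin f := rfl

/-- With a common carrier, equality of objects reduces to equality of actions, and the transport is
the identity on vectors. -/
lemma homLin_eqToHom {M : Type w} [AddCommGroup M] [Module k M] [FiniteDimensional k M]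
    {ρ ρ' : L →ₗ⁅k⁆ Module.End k M} (hρ : ρ = ρ')
    (h : (⟨M, ρ⟩ : FDMod.{u, v, w} k L) = ⟨M, ρ'⟩) : homLin (eqToHom h) = LinearMap.id := by
  subst hρ
  rfl

lemma fullSubcategory_eqToHom_hom {C : Type*} [Category C] {P : ObjectProperty C}
    {X Y : P.FullSubcategory} (h : X = Y) :
    (eqToHom h).hom = eqToHom (congrArg ObjectProperty.FullSubcategory.obj h) := by
  subst h
  rfl

end Hom

/-! ### The twisting and untwisting functors -/

section UntwistLemmas

attribute [local instance 100] LieRing.ofAssociativeRing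

variable {k : Type u} {A : Type*} {g : Type*} {Γ : Type*} [Field k] [CommRing A] [Algebra k A]
  [LieRing g] [LieAlgebra k g] [Group Γ] [MulSemiringAction Γ A] [SMulCommClass Γ k A]
  [LieMulAction Γ g] [SMulCommClass Γ k g]

section

variable {I : Ideal A} (hI : FixedSurj (k := k) g Γ I)
  (V : FDMod.{u, _, w} k (EMA k A g Γ)) (hV : Annihilates I V)

lemma untwist_rho_eq_zero {α : A ⊗[k] g} (hα : α ∈ tensorIdeal g I) :
    (untwist hI V hV).ρ α = 0 := by
  rw [untwist_rho hI V hV α 0 (by simpa using hα)]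
  exact map_zero V.ρ

/-- The action on `untwist`, as a representation on the space `V`. -/
def untwistRho : A ⊗[k] g →ₗ⁅k⁆ Module.End k V.carrier := (untwist hI V hV).ρ

lemma untwistRho_apply {β : A ⊗[k] g} {α : EMA k A g Γ}
    (h : (α : A ⊗[k] g) - β ∈ tensorIdeal g I) : untwistRho hI V hV β = V.ρ α :=
  untwist_rho hI V hV β α h

lemma untwist_rho_coe (α : EMA k A g Γ) : (untwist hI V hV).ρ α = V.ρ α :=
  untwist_rho hI V hV _ α (by simp)

lemma twistFunctor_obj_untwist : (twistFunctor k A g Γ).obj (untwist hI V hV) = V :=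
  congrArg (fun ρ => (⟨V.carrier, ρ⟩ : FDMod.{u, _, w} k (EMA k A g Γ)))
    (LieHom.ext (untwist_rho_coe hI V hV))

/-- Restriction to `(g ⊗ A)^Γ` does not change the constituents of modules annihilated by
`g ⊗ I`. -/
lemma isConstituent_twistFunctor_iff {S W : FDMod.{u, _, w} k (A ⊗[k] g)}
    (hI : FixedSurj (k := k) g Γ I)
    (hS : ∀ α ∈ tensorIdeal g I, S.ρ α = 0) (hW : ∀ α ∈ tensorIdeal g I, W.ρ α = 0) :
    IsConstituent ((twistFunctor k A g Γ).obj S) ((twistFunctor k A g Γ).obj W) ↔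
      IsConstituent S W :=
  isConstituent_pullback_iff fun β => by
    obtain ⟨α, hα⟩ := hI β
    exact ⟨α, rho_eq_of_sub_mem hS hα, rho_eq_of_sub_mem hW hα⟩

end

variable [Fintype Γ] (hfree : ActsFreely Γ k A) {x : Finset (RatPt k A)} (hx : x ∈ XStar Γ k A)

/-- A `(g ⊗ A)`-module annihilated by some `g ⊗ I_η'` is the untwisting of its restriction. -/
lemma untwist_rho_twistFunctor_obj {W : FDMod.{u, _, w} k (A ⊗[k] g)} {η η' : RatPt k A →₀ ℕ}
    (hη : η.support ⊆ x) (hη' : η'.support ⊆ x)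
    (hV : Annihilates (powIdeal η) ((twistFunctor k A g Γ).obj W))
    (hW : ∀ α ∈ tensorIdeal g (powIdeal η'), W.ρ α = 0) :
    (untwist (fixedSurj hfree hx hη) ((twistFunctor k A g Γ).obj W) hV).ρ = W.ρ := by
  refine LieHom.ext fun β => ?_
  obtain ⟨α, hα, hα'⟩ := exists_sub_mem_tensorIdeal hfree hx hη hη' β
  rw [untwist_rho _ _ hV β α hα]
  exact (rho_eq_of_sub_mem hW hα').symm

/-- One fixed lift can be taken modulo both ideals, so the untwisted action does not depend on the
exponent. -/
lemma untwistRho_congr {V : FDMod.{u, _, w} k (EMA k A g Γ)} {η η' : RatPt k A →₀ ℕ}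
    (hη : η.support ⊆ x) (hη' : η'.support ⊆ x) (hV : Annihilates (powIdeal η) V)
    (hV' : Annihilates (powIdeal η') V) :
    untwistRho (fixedSurj hfree hx hη) V hV = untwistRho (fixedSurj hfree hx hη') V hV' := by
  refine LieHom.ext fun β => ?_
  obtain ⟨α, hα, hα'⟩ := exists_sub_mem_tensorIdeal hfree hx hη hη' β
  rw [untwistRho_apply _ _ hV hα, untwistRho_apply _ _ hV' hα']

/-- A morphism of `(g ⊗ A)^Γ`-modules, as a morphism between untwisted modules for possibly
different exponents. -/
def untwistHom {V W : FDMod.{u, _, w} k (EMA k A g Γ)} {η η' : RatPt k A →₀ ℕ}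
    (hη : η.support ⊆ x) (hη' : η'.support ⊆ x) (hV : Annihilates (powIdeal η) V)
    (hW : Annihilates (powIdeal η') W) (f : V ⟶ W) :
    untwist (fixedSurj hfree hx hη) V hV ⟶ untwist (fixedSurj hfree hx hη') W hW :=
  { toLinearMap := LieModuleHom.toLinearMap (L := EMA k A g Γ) (M := V.carrier) (N := W.carrier) f
    map_lie' := fun {β m} => by
      obtain ⟨α, hα, hα'⟩ := exists_sub_mem_tensorIdeal hfree hx hη hη' β
      have h1 := untwist_rho (fixedSurj hfree hx hη) V hV β α hα
      have h2 := untwist_rho (fixedSurj hfree hx hη') W hW β α hα'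
      exact ((congrArg (homLin f) (LinearMap.congr_fun h1 m)).trans (homLin_map_rho f α m)).trans
        (LinearMap.congr_fun h2 (homLin f m)).symm }

/-- `T` maps `𝓕_x` to `𝓕^Γ_x`. -/
theorem FX.twist [LieAlgebra.IsSemisimple k g] [IsAlgClosed k] [CharZero k]
    [FiniteDimensional k g] (hfree : ActsFreely Γ k A) (hx : x ∈ XStar Γ k A)
    {V : FDMod.{u, _, w} k (A ⊗[k] g)} (hV : FX g x V) :
    FXΓ g Γ x ((twistFunctor k A g Γ).obj V) := by
  intro S hS
  obtain ⟨η, hη, hkill⟩ := hV.exists_annihilates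
  have hI : FixedSurj (k := k) g Γ (powIdeal η) := fixedSurj hfree hx hη
  have hSann : Annihilates (powIdeal η) S := fun α hα m =>
    LinearMap.congr_fun (hS.rho_eq_zero (a := α) (hkill α hα)) m
  -- A constituent of the restriction is itself the restriction of its untwisting, which is a
  -- constituent of `V`.
  have hT := twistFunctor_obj_untwist hI S hSann
  rw [← hT, isConstituent_twistFunctor_iff hI (fun α => untwist_rho_eq_zero hI S hSann) hkill]
    at hS
  obtain ⟨ψ, hψ, hev, hsupp⟩ := hV _ hS
  obtain ⟨s, hs⟩ := Set.Finite.exists_finset_coe (show (supp ψ).Finite from hψ)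
  have hfin : supp ψ = s := hs.symm
  have hsx : s ⊆ x := fun y hy => hsupp (hfin ▸ hy)
  have hstar : s ∈ XStar Γ k A := fun y hy z hz => hx y (hsx hy) z (hsx hz)
  refine ⟨_, twistFun_mem hfree hstar hfin, hT ▸ hev.twist hfree hstar hfin, ?_⟩
  rw [supp_twistFun hfree hstar hfin]
  rintro _ ⟨γ, y, hy, rfl⟩
  exact ⟨γ, y, hsx hy, rfl⟩

/-- Untwisting maps `𝓕^Γ_x` to `𝓕_x`. -/
theorem FXΓ.untwist {V : FDMod.{u, _, w} k (EMA k A g Γ)} (hV : FXΓ g Γ x V)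
    {η : RatPt k A →₀ ℕ} (hη : η.support ⊆ x) (hann : Annihilates (powIdeal η) V) :
    FX g x (EquivMap.untwist (fixedSurj hfree hx hη) V hann) := by
  intro S hS
  have hI : FixedSurj (k := k) g Γ (powIdeal η) := fixedSurj hfree hx hη
  have hW : ∀ α ∈ tensorIdeal g (powIdeal η), (EquivMap.untwist hI V hann).ρ α = 0 :=
    fun α => untwist_rho_eq_zero hI V hann
  have hSkill : ∀ α ∈ tensorIdeal g (powIdeal η), S.ρ α = 0 := fun α hα =>
    hS.rho_eq_zero (hW α hα)
  have hTS := (isConstituent_twistFunctor_iff hI hSkill hW).mpr hS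
  rw [twistFunctor_obj_untwist hI V hann] at hTS
  obtain ⟨ψ, hψ, hev, hsupp⟩ := hV _ hTS
  refine ⟨_, restrictFun_mem_EE x ψ, hev.isEv_restrictFun hfree hx hη hSkill hψ hsupp, ?_⟩
  rw [supp_restrictFun]
  exact fun y hy => hy.1

/-- The modules in `ev^Γ_ψ` lie in `𝓕^Γ_x`. -/
theorem IsEvΓ.mem_FXΓ [IsAlgClosed k] (hfree : ActsFreely Γ k A)
    {ψ : RatPt k A → PPlus k g} (hψ : ψ ∈ EEΓ k A g Γ)
    (hsupp : supp ψ ⊆ orbits Γ (x : Set (RatPt k A))) {V : FDMod.{u, _, w} k (EMA k A g Γ)}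
    (hV : IsEvΓ ψ V) : FXΓ g Γ x V := by
  intro S hS
  obtain ⟨s, hs, hev⟩ := hV
  obtain ⟨e⟩ := hS.nonempty_equiv (hev.isIrreducible hfree (transversals_subset_XStar hs))
  exact ⟨ψ, hψ, ⟨s, hs, hev.of_equiv e⟩, hsupp⟩

variable [LieAlgebra.IsSemisimple k g] [IsAlgClosed k] [CharZero k] [Algebra.FiniteType k A]

/-- An exponent `η` supported in `x` such that `(g ⊗ I_η)^Γ` annihilates the module. -/
def annExp (V : (FXΓ.{u, w} g Γ x).FullSubcategory) : RatPt k A →₀ ℕ :=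
  (V.property.exists_annihilates hfree hx).choose

lemma annExp_support (V : (FXΓ.{u, w} g Γ x).FullSubcategory) :
    (annExp hfree hx V).support ⊆ x :=
  (V.property.exists_annihilates hfree hx).choose_spec.1

lemma annExp_annihilates (V : (FXΓ.{u, w} g Γ x).FullSubcategory) :
    Annihilates (powIdeal (annExp hfree hx V)) V.obj :=
  (V.property.exists_annihilates hfree hx).choose_spec.2

/-- The untwisting functor `U_x`. -/
def untwistFunctor :
    (FXΓ.{u, w} g Γ x).FullSubcategory ⥤ (FX.{u, w} g x).FullSubcategory where
  obj V := ⟨untwist (fixedSurj hfree hx (annExp_support hfree hx V)) V.obj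
      (annExp_annihilates hfree hx V),
    V.property.untwist hfree hx (annExp_support hfree hx V) (annExp_annihilates hfree hx V)⟩
  map {V W} f := ObjectProperty.homMk (untwistHom hfree hx (annExp_support hfree hx V)
    (annExp_support hfree hx W) (annExp_annihilates hfree hx V) (annExp_annihilates hfree hx W)
    f.hom)

lemma untwistFunctor_obj_eq (V : (FXΓ.{u, w} g Γ x).FullSubcategory) {η : RatPt k A →₀ ℕ}
    (hη : η.support ⊆ x) (hV : Annihilates (powIdeal η) V.obj) :
    ((untwistFunctor hfree hx).obj V).obj = untwist (fixedSurj hfree hx hη) V.obj hV :=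
  congrArg (fun ρ => (⟨V.obj.carrier, ρ⟩ : FDMod.{u, _, w} k (A ⊗[k] g)))
    (untwistRho_congr hfree hx (annExp_support hfree hx V) hη (annExp_annihilates hfree hx V) hV)

lemma isUntwisting_untwistFunctor :
    IsUntwisting.{u, w} (g := g) hfree hx (untwistFunctor hfree hx) where
  exists_annihilates V := ⟨_, annExp_support hfree hx V, annExp_annihilates hfree hx V⟩
  obj_eq V η hη hV := untwistFunctor_obj_eq hfree hx V hη hV
  map_eq V W f η hη hV hW := by
    apply homLin_injective
    rw [homLin_comp, homLin_comp]
    erw [homLin_eqToHom (untwistRho_congr hfree hx (annExp_support hfree hx V) hη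
      (annExp_annihilates hfree hx V) hV), homLin_eqToHom (untwistRho_congr hfree hx hη
      (annExp_support hfree hx W) hW (annExp_annihilates hfree hx W))]
    rfl

/-- The exponent chosen for the restriction is only known to kill through fixed elements, so it is
compared with one for which all of `g ⊗ I_η` kills `V`. -/
lemma untwistFunctor_obj_twistFunctor_obj_rho [FiniteDimensional k g]
    (V : (FX.{u, w} g x).FullSubcategory)
    (hT : FXΓ.{u, w} g Γ x ((twistFunctor k A g Γ).obj V.obj)) :
    ((untwistFunctor hfree hx).obj ⟨_, hT⟩).obj.ρ = V.obj.ρ := by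
  obtain ⟨η, hη, hkill⟩ := V.property.exists_annihilates
  exact untwist_rho_twistFunctor_obj hfree hx (annExp_support hfree hx _) hη
    (annExp_annihilates hfree hx _) hkill

theorem twistFunctorAt_comp_untwistFunctor [FiniteDimensional k g]
    (hT : ∀ V : (FX.{u, w} g x).FullSubcategory,
      FXΓ.{u, w} g Γ x ((twistFunctor k A g Γ).obj V.obj)) :
    twistFunctorAt x hT ⋙ untwistFunctor hfree hx = 𝟭 _ := by
  have hρ := fun V => untwistFunctor_obj_twistFunctor_obj_rho hfree hx V (hT V)
  refine CategoryTheory.Functor.ext (fun V => ObjectProperty.FullSubcategory.ext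
    (congrArg (fun ρ => (⟨V.obj.carrier, ρ⟩ : FDMod.{u, _, w} k (A ⊗[k] g))) (hρ V)))
    fun V W f => ?_
  apply ObjectProperty.hom_ext
  apply homLin_injective
  rw [ObjectProperty.FullSubcategory.comp_hom, ObjectProperty.FullSubcategory.comp_hom,
    fullSubcategory_eqToHom_hom, fullSubcategory_eqToHom_hom, homLin_comp, homLin_comp]
  erw [homLin_eqToHom (hρ V), homLin_eqToHom (hρ W).symm]
  rfl

theorem untwistFunctor_comp_twistFunctorAt [FiniteDimensional k g]
    (hT : ∀ V : (FX.{u, w} g x).FullSubcategory,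
      FXΓ.{u, w} g Γ x ((twistFunctor k A g Γ).obj V.obj)) :
    untwistFunctor hfree hx ⋙ twistFunctorAt x hT = 𝟭 _ := by
  have hρ : ∀ V : (FXΓ.{u, w} g Γ x).FullSubcategory,
      ((twistFunctor k A g Γ).obj ((untwistFunctor hfree hx).obj V).obj).ρ = V.obj.ρ := fun V =>
    LieHom.ext (untwist_rho_coe (fixedSurj hfree hx (annExp_support hfree hx V)) V.obj
      (annExp_annihilates hfree hx V))
  refine CategoryTheory.Functor.ext (fun V => ObjectProperty.FullSubcategory.ext
    (congrArg (fun ρ => (⟨V.obj.carrier, ρ⟩ : FDMod.{u, _, w} k (EMA k A g Γ))) (hρ V)))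
    fun V W f => ?_
  apply ObjectProperty.hom_ext
  apply homLin_injective
  rw [ObjectProperty.FullSubcategory.comp_hom, ObjectProperty.FullSubcategory.comp_hom,
    fullSubcategory_eqToHom_hom, fullSubcategory_eqToHom_hom, homLin_comp, homLin_comp]
  erw [homLin_eqToHom (hρ V), homLin_eqToHom (hρ W).symm]
  rfl

end UntwistLemmas

end EquivMap

end

/-! ### The main theorem -/

open EquivMap in
theorem mainTheorem1
    {k : Type u} {A g Γ : Type*} [Field k] [IsAlgClosed k] [CharZero k]
    [CommRing A] [Algebra k A] [Algebra.FiniteType k A]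
    [LieRing g] [LieAlgebra k g] [FiniteDimensional k g] [LieAlgebra.IsSemisimple k g]
    [CommGroup Γ] [Fintype Γ]
    [MulSemiringAction Γ A] [SMulCommClass Γ k A]
    [LieMulAction Γ g] [SMulCommClass Γ k g]
    (hfree : ActsFreely Γ k A)
    (x : Finset (RatPt k A)) (hx : x ∈ XStar Γ k A) :
    -- `T` maps `ev_ψ` to `ev^Γ_{ψ^Γ}`
    (∀ ψ ∈ EE k A g, (∃ s ∈ XStar Γ k A, supp ψ = s) →
      twistFun (Γ := Γ) ψ ∈ EEΓ k A g Γ ∧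
      ∀ V : FDMod.{u, _, w} k (A ⊗[k] g), IsEv ψ V →
        IsEvΓ (twistFun (Γ := Γ) ψ) ((twistFunctor k A g Γ).obj V)) ∧
    -- `T` restricts to `T_x : 𝓕_x ⥤ 𝓕^Γ_x`, and the untwisting functor `U_x` is well defined
    ∃ (hT : ∀ V : (FX.{u, w} g x).FullSubcategory,
        FXΓ.{u, w} g Γ x ((twistFunctor k A g Γ).obj V.obj))
      (U : (FXΓ.{u, w} g Γ x).FullSubcategory ⥤ (FX.{u, w} g x).FullSubcategory),
      IsUntwisting hfree hx U ∧
      -- `U_x` maps `ev^Γ_ψ` to `ev_{ψ_x}`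
      (∀ ψ ∈ EEΓ k A g Γ, supp ψ ⊆ orbits Γ (x : Set (RatPt k A)) →
        restrictFun x ψ ∈ EE k A g ∧
        ∀ V : FDMod.{u, _, w} k (EMA k A g Γ), IsEvΓ ψ V →
          ∃ hV : FXΓ.{u, w} g Γ x V, IsEv (restrictFun x ψ) (U.obj ⟨V, hV⟩).obj) ∧
      -- `T_x` and `U_x` are mutually inverse isomorphisms of categories
      twistFunctorAt x hT ⋙ U = 𝟭 _ ∧ U ⋙ twistFunctorAt x hT = 𝟭 _ := by
  refine ⟨fun ψ _ ⟨s, hs, hψ⟩ => ⟨twistFun_mem hfree hs hψ, fun V hV => hV.twist hfree hs hψ⟩,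
    fun V => V.property.twist hfree hx, untwistFunctor hfree hx,
    isUntwisting_untwistFunctor hfree hx,
    fun ψ hψ hsupp => ⟨restrictFun_mem_EE x ψ, fun V hV => ?_⟩,
    twistFunctorAt_comp_untwistFunctor hfree hx _, untwistFunctor_comp_twistFunctorAt hfree hx _⟩
  have hmem : FXΓ.{u, w} g Γ x V := hV.mem_FXΓ hfree hψ hsupp
  refine ⟨hmem, IsEvΓ.isEv_restrictFun hfree hx (annExp_support hfree hx ⟨V, hmem⟩)
    (fun α => untwist_rho_eq_zero _ _ (annExp_annihilates hfree hx ⟨V, hmem⟩)) hψ hsupp ?_⟩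
  -- The untwisted module restricts to `V` itself, so its restriction is in `ev^Γ_ψ`.
  have h := twistFunctor_obj_untwist (fixedSurj hfree hx (annExp_support hfree hx ⟨V, hmem⟩)) V
    (annExp_annihilates hfree hx ⟨V, hmem⟩)
  exact h.symm ▸ hV
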